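/- For $j\in\{0,1\}$, $t\in\mathbb R$ and $r>0$ put $$\mathcal J_j(t,r)=\frac1{\sqrt{2\pi}}\int_0^\infty \frac{\exp(-(r-t+r\xi)^2/2)}{\sqrt{\xi(\xi+2)}}\,(r-t+r\xi)(1+\xi)^j\,d\xi,$$ $$\tilde W(t,r)=\frac1{\sqrt{2\pi}}\int_0^\infty \frac{1}{\sqrt{\xi}\sqrt{\xi+2}}\exp\left(-\frac{(r-t+\xi r)^2}{2}\right)d\xi .$$ These integrals converge absolutely. Define, for $t\ge0$ and $r>0$, $$p'(t,r)=\mathcal J_0(t,r)+\mathcal J_0(-t,r),\qquad u_r'(t,r)=\mathcal J_1(t,r)-\mathcal J_1(-t,r),\qquad W(t,r)=-\tilde W(t,r)+\tilde W(-t,r).$$ Then: (1) $W$ is of class $C^2$ on $[0,\infty)\times(0,\infty)$ and solves the radial Cauchy problem $$\frac{\partial^2 W}{\partial t^2}-\frac1r\frac{\partial}{\partial r}\left(r\frac{\partial W}{\partial r}\right)=0\quad(t>0,\ r>0),\qquad W|_{t=0}=0,\qquad \left.\frac{\partial W}{\partial t}\right|_{t=0}=-e^{-r^2/2},$$ and $p'=-\partial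 W/\partial t$, $u_r'=\partial W/\partial r$ for all $t\ge0$, $r>0$ (time derivatives at $t=0$ are one-sided). (2) There is a $C^1$ solution $(p,\mathbf u)$ on $[0,\infty)\times\mathbb R^2$ of the acoustic Cauchy problem $$\partial_t p+\nabla\cdot\mathbf u=0,\qquad \partial_t\mathbf u+\nabla p=0\quad(t>0),\qquad p(0,\mathbf x)=e^{-|\mathbf x|^2/2},\qquad \mathbf u(0,\mathbf x)=0,$$ such that $p(t,\mathbf x)=p'(t,|\mathbf x|)$ and $\mathbf u(t,\mathbf x)=u_r'(t,|\mathbf x|)\,\mathbf x/|\mathbf x|$ for all $t\ge0$ and $\mathbf x\ne0$. (3) For all $t\ge0$ and $r>0$, $$p'(t,r)=\int_0^\infty \omega e^{-\omega^2/2}J_0(r\omega)\cos(t\omega)\,d\omega,\qquad u_r'(t,r)=\int_0^\infty \omega e^{-\omega^2/2}J_1(r\omega)\sin(t\omega)\,d\omega,$$ where the integrals converge absolutely and $J_0,J_1$ are the Bessel functions of the first kind. -/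

import Mathlib

open MeasureTheory Set

noncomputable section

namespace AcousticPulse

/-- The Bessel function `J_n` of the first kind of integer index (Bessel's integral). -/
def besselJ (n : ℕ) (x : ℝ) : ℝ :=
  1 / Real.pi * ∫ θ in (0 : ℝ)..Real.pi, Real.cos (n * θ - x * Real.sin θ)

/-- The integrand of `calJ j t r`, as a function of `ξ`. -/
def calJIntegrand (j : ℕ) (t r ξ : ℝ) : ℝ :=
  Real.exp (-(r - t + r * ξ) ^ 2 / 2) / Real.sqrt (ξ * (ξ + 2)) *
    (r - t + r * ξ) * (1 + ξ) ^ j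

/-- The integral `𝒥_j(t, r)`. -/
def calJ (j : ℕ) (t r : ℝ) : ℝ :=
  1 / Real.sqrt (2 * Real.pi) * ∫ ξ in Ioi (0 : ℝ), calJIntegrand j t r ξ

/-- `p'(t, r) = 𝒥_0(t, r) + 𝒥_0(-t, r)`. -/
def pressure (t r : ℝ) : ℝ := calJ 0 t r + calJ 0 (-t) r

/-- `u_r'(t, r) = 𝒥_1(t, r) - 𝒥_1(-t, r)`. -/
def radialVelocity (t r : ℝ) : ℝ := calJ 1 t r - calJ 1 (-t) r

/-- The integrand of `halfPotential t r`, as a function of `ξ`. -/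
def halfPotentialIntegrand (t r ξ : ℝ) : ℝ :=
  1 / (Real.sqrt ξ * Real.sqrt (ξ + 2)) * Real.exp (-(r - t + ξ * r) ^ 2 / 2)

/-- The integral `W̃(t, r)`. -/
def halfPotential (t r : ℝ) : ℝ :=
  1 / Real.sqrt (2 * Real.pi) * ∫ ξ in Ioi (0 : ℝ), halfPotentialIntegrand t r ξ

/-- `W(t, r) = -W̃(t, r) + W̃(-t, r)`. -/
def potential (t r : ℝ) : ℝ := -halfPotential t r + halfPotential (-t) r

/-- `W(t, r)` is a classical solution, for `t ≥ 0` and `r > 0`, of the radial wave equation in two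
space dimensions with `W = 0` and `∂W/∂t = -exp(-r²/2)` at `t = 0`, and `p`, `u` are the pressure
and the radial velocity derived from it. Time derivatives at `t = 0` are one-sided. -/
structure IsRadialSolution (W p u : ℝ → ℝ → ℝ) : Prop where
  contDiffOn : ContDiffOn ℝ 2 (fun z : ℝ × ℝ => W z.1 z.2) (Ici 0 ×ˢ Ioi 0)
  wave_eq : ∀ t r : ℝ, 0 < t → 0 < r →
    iteratedDeriv 2 (fun s => W s r) t
      - 1 / r * deriv (fun ρ => ρ * deriv (fun y => W t y) ρ) r = 0
  init_value : ∀ r : ℝ, 0 < r → W 0 r = 0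
  init_deriv : ∀ r : ℝ, 0 < r →
    HasDerivWithinAt (fun s => W s r) (-Real.exp (-r ^ 2 / 2)) (Ici 0) 0
  pressure_eq : ∀ t r : ℝ, 0 ≤ t → 0 < r →
    HasDerivWithinAt (fun s => W s r) (-p t r) (Ici 0) t
  velocity_eq : ∀ t r : ℝ, 0 ≤ t → 0 < r → HasDerivAt (fun y => W t y) (u t r) r

/-- `(p, u)` is a classical solution, for `t ≥ 0`, of the acoustic system
`∂p/∂t + ∇ · u = 0`, `∂u/∂t + ∇p = 0` in the whole plane, with initial data
`p = exp(-|x|²/2)`, `u = 0`. -/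
structure IsPlanarAcousticSolution (p : ℝ → EuclideanSpace ℝ (Fin 2) → ℝ)
    (u : ℝ → EuclideanSpace ℝ (Fin 2) → EuclideanSpace ℝ (Fin 2)) : Prop where
  contDiffOn_p : ContDiffOn ℝ 1
    (fun z : ℝ × EuclideanSpace ℝ (Fin 2) => p z.1 z.2) (Ici 0 ×ˢ univ)
  contDiffOn_u : ContDiffOn ℝ 1
    (fun z : ℝ × EuclideanSpace ℝ (Fin 2) => u z.1 z.2) (Ici 0 ×ˢ univ)
  mass_eq : ∀ (t : ℝ) (x : EuclideanSpace ℝ (Fin 2)), 0 < t →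
    deriv (fun s => p s x) t
      + ∑ i : Fin 2, (fderiv ℝ (u t) x (EuclideanSpace.single i 1)) i = 0
  momentum_eq : ∀ (t : ℝ) (x : EuclideanSpace ℝ (Fin 2)), 0 < t →
    deriv (fun s => u s x) t + gradient (p t) x = 0
  init_p : ∀ x : EuclideanSpace ℝ (Fin 2), p 0 x = Real.exp (-‖x‖ ^ 2 / 2)
  init_u : ∀ x : EuclideanSpace ℝ (Fin 2), u 0 x = 0

end AcousticPulse

end

/-! The pulse is a superposition of plane waves. With n = (sin θ, cos θ), let Φ(t, x) be the
integral of sin(ω(t + x·n)) e^{-ω²/2}/(2π) over ω > 0 and -π < θ < π. Each plane wave solves the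
acoustic system because |n| = 1, and the Gaussian makes every moment in ω finite. So p = ∂Φ/∂t and u
= -∇Φ form a solution that is regular also at the origin, where the radial formulas are singular. At
t = 0 the integral for p is, in polar coordinates, the Fourier transform of a planar Gaussian
(`planarPressure_zero`).

Averaging over θ turns plane waves into Bessel functions. This gives the Fourier-Bessel integrals
and Φ(t, x) = ∫ e^{-ω²/2} J₀(|x|ω) sin(tω) dω.

The core is the identity W(t, |x|) = -Φ(t, x) (`potential_eq_planarPotential`). The Gaussian
e^{-ω²/2} is written as a Fourier integral in τ, and the ω-integral becomes the Laplace transform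
1/√(p² + r²) of J₀ at p = δ - iτ (`laplace_besselJ_zero`). As δ → 0+ this tends to 1/√(r² - τ²),
whose imaginary part lives on |τ| > r and is odd in τ (`im_besselTransform`). The half-lines τ > r
and τ < -r yield W̃(t, r) and W̃(-t, r).

Differentiating W̃ under the integral sign produces 𝒥₀ and -𝒥₁. Comparison with the derivatives of Φ
then identifies p' and u_r' with the planar fields, and every remaining claim is transported from
the plane. -/

namespace AcousticPulse

/-! ### Differentiation of oscillatory integrals with a linear phase. -/

section OscillatoryIntegral

variable {Y E F : Type} [NormedAddCommGroup E] [NormedSpace ℝ E] [NormedAddCommGroup F]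
  [NormedSpace ℝ F] {φ : Y → E →L[ℝ] ℝ} {A : Y → F}

/-- The oscillatory integral with phase `φ`, phase shift `c` and amplitude `A`. -/
noncomputable def oscIntegral [MeasurableSpace Y] (μ : Measure Y) (φ : Y → E →L[ℝ] ℝ) (c : ℝ) (A : Y → F) (z : E) : F :=
  ∫ y, Real.cos (φ y z + c) • A y ∂μ

theorem continuous_oscIntegrand [TopologicalSpace Y] (hφ : Continuous φ) (hA : Continuous A) (c : ℝ) (z : E) :
    Continuous fun y => Real.cos (φ y z + c) • A y := by
  fun_prop

theorem norm_oscIntegrand_le (c : ℝ) (z : E) (y : Y) :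
    ‖Real.cos (φ y z + c) • A y‖ ≤ ‖A y‖ := by
  rw [norm_smul]
  exact mul_le_of_le_one_left (norm_nonneg _) (Real.abs_cos_le_one _)

theorem continuous_smulRight [TopologicalSpace Y] (hφ : Continuous φ) (hA : Continuous A) :
    Continuous fun y => (φ y).smulRight (A y) :=
  (ContinuousLinearMap.smulRightL ℝ E F).isBoundedBilinearMap.continuous.comp (hφ.prodMk hA)

variable [TopologicalSpace Y] [SecondCountableTopology Y] [MeasurableSpace Y]
  [OpensMeasurableSpace Y] {μ : Measure Y}

theorem integrable_oscIntegrand (hφ : Continuous φ) (hA : Continuous A)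
    (hint : Integrable (fun y => ‖A y‖) μ) (c : ℝ) (z : E) :
    Integrable (fun y => Real.cos (φ y z + c) • A y) μ :=
  hint.mono' (continuous_oscIntegrand hφ hA c z).aestronglyMeasurable
    (.of_forall fun y => norm_oscIntegrand_le c z y)

theorem continuous_oscIntegral (hφ : Continuous φ) (hA : Continuous A)
    (hint : Integrable (fun y => ‖A y‖) μ) (c : ℝ) :
    Continuous (oscIntegral μ φ c A) := by
  refine continuous_of_dominated (fun z => (continuous_oscIntegrand hφ hA c z).aestronglyMeasurable)
    (fun z => .of_forall fun y => norm_oscIntegrand_le c z y) hint (.of_forall fun y => ?_)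
  fun_prop

/-- The derivative of cos is cos advanced by π/2, so differentiation stays inside the family
`oscIntegral`: it shifts `c` and replaces the amplitude `A` by `φ ⊗ A`. -/
theorem hasFDerivAt_oscIntegral (hφ : Continuous φ) (hA : Continuous A)
    (hint : Integrable (fun y => ‖A y‖) μ) (hint' : Integrable (fun y => ‖φ y‖ * ‖A y‖) μ)
    (c : ℝ) (z : E) :
    HasFDerivAt (oscIntegral μ φ c A)
      (oscIntegral μ φ (c + Real.pi / 2) (fun y => (φ y).smulRight (A y)) z) z := by
  have hs := continuous_smulRight hφ hA
  refine hasFDerivAt_integral_of_dominated_of_fderiv_le (Filter.univ_mem)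
    (.of_forall fun z => (continuous_oscIntegrand hφ hA c z).aestronglyMeasurable)
    (integrable_oscIntegrand hφ hA hint c z)
    (F' := fun z y => Real.cos (φ y z + (c + Real.pi / 2)) • (φ y).smulRight (A y))
    (continuous_oscIntegrand hφ hs _ z).aestronglyMeasurable
    (.of_forall fun y x _ => ?_) hint' (.of_forall fun y x _ => ?_)
  · exact (norm_oscIntegrand_le (A := fun y => (φ y).smulRight (A y)) _ x y).trans_eq (ContinuousLinearMap.norm_smulRight_apply _ _)
  · have h1 : HasFDerivAt (fun z => φ y z + c) (φ y) x := (φ y).hasFDerivAt.add_const c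
    have h2 := (h1.cos).smul_const (A y)
    convert h2 using 1
    ext v
    simp only [← add_assoc, Real.cos_add_pi_div_two]
    simp [mul_smul]

theorem contDiff_oscIntegral {n : ℕ} (hφ : Continuous φ) (hA : Continuous A)
    (hint : ∀ k ≤ n, Integrable (fun y => ‖φ y‖ ^ k * ‖A y‖) μ) (c : ℝ) :
    ContDiff ℝ n (oscIntegral μ φ c A) := by
  -- Each derivative changes the amplitude, its target space and the phase shift, so all three must
  -- vary in the induction.
  induction n generalizing F A c with
  | zero =>
    have := hint 0 le_rfl
    exact contDiff_zero.2 (continuous_oscIntegral hφ hA (by simpa using this) c)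
  | succ n ih =>
    have h0 := hint 0 (Nat.zero_le _)
    have h1 := hint 1 (by omega)
    push_cast
    refine contDiff_succ_iff_hasFDerivAt.2 ⟨_, ih (continuous_smulRight hφ hA) (fun k hk => ?_) _,
      hasFDerivAt_oscIntegral hφ hA (by simpa using h0) (by simpa using h1) c⟩
    refine (hint (k + 1) (by omega)).congr (.of_forall fun y => ?_)
    simp only [ContinuousLinearMap.norm_smulRight_apply]
    ring

theorem oscIntegral_smulRight_apply (hφ : Continuous φ) (hA : Continuous A)
    (hint' : Integrable (fun y => ‖φ y‖ * ‖A y‖) μ) (c : ℝ) (z v : E) [CompleteSpace F] :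
    oscIntegral μ φ c (fun y => (φ y).smulRight (A y)) z v =
      oscIntegral μ φ c (fun y => φ y v • A y) z := by
  have hs := continuous_smulRight hφ hA
  have := integrable_oscIntegrand (μ := μ) hφ hs
    (hint'.congr (.of_forall fun y => by simp [ContinuousLinearMap.norm_smulRight_apply])) c z
  simp only [oscIntegral]
  rw [ContinuousLinearMap.integral_apply this]
  rfl

end OscillatoryIntegral

/-! ### Superposition of plane waves with Gaussian weight. -/

section PlaneWaves

/-- The phase `ω (t + x₀ sin θ + x₁ cos θ)` of a plane wave, as a linear form in `(t, x)`. -/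
noncomputable def phase (y : ℝ × ℝ) : ℝ × EuclideanSpace ℝ (Fin 2) →L[ℝ] ℝ :=
  y.1 • (ContinuousLinearMap.fst ℝ ℝ (EuclideanSpace ℝ (Fin 2)) +
    (Real.sin y.2 • (EuclideanSpace.proj 0 : EuclideanSpace ℝ (Fin 2) →L[ℝ] ℝ) +
      Real.cos y.2 • (EuclideanSpace.proj 1 : EuclideanSpace ℝ (Fin 2) →L[ℝ] ℝ)).comp
      (ContinuousLinearMap.snd ℝ ℝ (EuclideanSpace ℝ (Fin 2))))

/-- The Gaussian weight of the plane wave of frequency `ω`. -/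
noncomputable def weight (y : ℝ × ℝ) : ℝ := 1 / (2 * Real.pi) * Real.exp (-y.1 ^ 2 / 2)

/-- The measure `dω dθ` on `(0, ∞) × (-π, π)`. -/
noncomputable def polarMeasure : Measure (ℝ × ℝ) := volume.restrict polarCoord.target

/-- The direction of the plane wave with angle `θ`. -/
noncomputable def direction (y : ℝ × ℝ) : EuclideanSpace ℝ (Fin 2) :=
  !₂[Real.sin y.2, Real.cos y.2]

theorem phase_apply (y : ℝ × ℝ) (z : ℝ × EuclideanSpace ℝ (Fin 2)) :
    phase y z = y.1 * (z.1 + (Real.sin y.2 * z.2 0 + Real.cos y.2 * z.2 1)) := by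
  simp [phase]
  ring

theorem continuous_phase : Continuous phase := by
  unfold phase
  fun_prop

theorem continuous_weight : Continuous weight := by
  unfold weight
  fun_prop

theorem continuous_direction : Continuous direction := by
  unfold direction
  refine (PiLp.continuous_toLp 2 _).comp (continuous_pi fun i => ?_)
  fin_cases i
  · exact Real.continuous_sin.comp continuous_snd
  · exact Real.continuous_cos.comp continuous_snd

theorem weight_nonneg (y : ℝ × ℝ) : 0 ≤ weight y := by
  unfold weight
  positivity

theorem norm_direction (y : ℝ × ℝ) : ‖direction y‖ = 1 := by
  simp [direction, EuclideanSpace.norm_eq]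

theorem norm_phase_le (y : ℝ × ℝ) : ‖phase y‖ ≤ 3 * |y.1| := by
  refine ContinuousLinearMap.opNorm_le_bound _ (by positivity) fun z => ?_
  rw [phase_apply, Real.norm_eq_abs, abs_mul]
  have h0 : |z.1| ≤ ‖z‖ := norm_fst_le z
  have hx (i : Fin 2) : |z.2 i| ≤ ‖z‖ := (PiLp.norm_apply_le z.2 i).trans (norm_snd_le z)
  have h1 : |Real.sin y.2 * z.2 0| ≤ ‖z‖ := by
    rw [abs_mul]
    exact (mul_le_of_le_one_left (abs_nonneg _) (Real.abs_sin_le_one _)).trans (hx 0)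
  have h2 : |Real.cos y.2 * z.2 1| ≤ ‖z‖ := by
    rw [abs_mul]
    exact (mul_le_of_le_one_left (abs_nonneg _) (Real.abs_cos_le_one _)).trans (hx 1)
  have h3 : |z.1 + (Real.sin y.2 * z.2 0 + Real.cos y.2 * z.2 1)| ≤ 3 * ‖z‖ :=
    (abs_add_le _ _).trans (by linarith [abs_add_le (Real.sin y.2 * z.2 0) (Real.cos y.2 * z.2 1)])
  calc _ ≤ |y.1| * (3 * ‖z‖) := by gcongr
    _ = _ := by ring

theorem polarMeasure_eq_prod :
    polarMeasure =
      (volume.restrict (Ioi (0 : ℝ))).prod (volume.restrict (Ioo (-Real.pi) Real.pi)) := by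
  rw [Measure.prod_restrict]
  rfl

theorem integrable_pow_mul_gaussian (k : ℕ) :
    IntegrableOn (fun ω : ℝ => ω ^ k * Real.exp (-ω ^ 2 / 2)) (Ioi 0) := by
  refine (integrableOn_rpow_mul_exp_neg_mul_sq (b := 1 / 2) (by norm_num)
    (s := k) (by linarith [k.cast_nonneg (α := ℝ)])).congr_fun (fun ω _ => ?_) measurableSet_Ioi
  simp only [Real.rpow_natCast]
  congr 2
  ring

theorem integrable_pow_mul_weight (k : ℕ) :
    Integrable (fun y => y.1 ^ k * weight y) polarMeasure := by
  rw [polarMeasure_eq_prod]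
  have := (integrable_pow_mul_gaussian k).integrable.mul_prod
    (integrable_const (μ := volume.restrict (Ioo (-Real.pi) Real.pi)) (1 / (2 * Real.pi)))
  refine this.congr (.of_forall fun y => ?_)
  simp only [weight]
  ring

theorem ae_polarMeasure_pos : ∀ᵐ y ∂polarMeasure, 0 < y.1 := by
  filter_upwards [self_mem_ae_restrict (polarCoord.open_target.measurableSet)] with y hy
  exact hy.1

theorem integrable_phase_pow_mul {F : Type} [NormedAddCommGroup F] {A : ℝ × ℝ → F}
    (hA : Continuous A) {m : ℕ} (hbound : ∀ y, ‖A y‖ ≤ |y.1| ^ m * weight y) (k : ℕ) :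
    Integrable (fun y => ‖phase y‖ ^ k * ‖A y‖) polarMeasure := by
  refine ((integrable_pow_mul_weight (k + m)).const_mul (3 ^ k)).mono'
    ((continuous_phase.norm.pow k).mul hA.norm).aestronglyMeasurable ?_
  filter_upwards [ae_polarMeasure_pos] with y hy
  rw [Real.norm_of_nonneg (by positivity)]
  calc _ ≤ (3 * |y.1|) ^ k * (|y.1| ^ m * weight y) :=
        mul_le_mul (pow_le_pow_left₀ (norm_nonneg _) (norm_phase_le y) k) (hbound y)
          (norm_nonneg _) (by positivity)
    _ = _ := by rw [abs_of_pos hy]; ring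

/-- The velocity potential of the pulse in the plane, with the sign of `∂Φ/∂t = p`. -/
noncomputable def planarPotential : ℝ × EuclideanSpace ℝ (Fin 2) → ℝ :=
  oscIntegral polarMeasure phase (-(Real.pi / 2)) weight

/-- The pressure of the pulse in the plane. -/
noncomputable def planarPressure : ℝ × EuclideanSpace ℝ (Fin 2) → ℝ :=
  oscIntegral polarMeasure phase 0 (fun y => y.1 * weight y)

/-- The velocity of the pulse in the plane. -/
noncomputable def planarVelocity :
    ℝ × EuclideanSpace ℝ (Fin 2) → EuclideanSpace ℝ (Fin 2) :=
  oscIntegral polarMeasure phase 0 (fun y => (-(y.1 * weight y)) • direction y)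

theorem continuous_pressureAmplitude : Continuous fun y : ℝ × ℝ => y.1 * weight y :=
  continuous_fst.mul continuous_weight

theorem continuous_velocityAmplitude :
    Continuous fun y : ℝ × ℝ => (-(y.1 * weight y)) • direction y :=
  continuous_pressureAmplitude.neg.smul continuous_direction

theorem integrable_potentialAmplitude (k : ℕ) :
    Integrable (fun y => ‖phase y‖ ^ k * ‖weight y‖) polarMeasure :=
  integrable_phase_pow_mul continuous_weight (m := 0)
    (fun y => by simp [abs_of_nonneg (weight_nonneg y)]) k

theorem integrable_pressureAmplitude (k : ℕ) :
    Integrable (fun y => ‖phase y‖ ^ k * ‖y.1 * weight y‖) polarMeasure :=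
  integrable_phase_pow_mul continuous_pressureAmplitude (m := 1)
    (fun y => by simp [abs_of_nonneg (weight_nonneg y)]) k

theorem integrable_velocityAmplitude (k : ℕ) :
    Integrable (fun y => ‖phase y‖ ^ k * ‖(-(y.1 * weight y)) • direction y‖) polarMeasure :=
  integrable_phase_pow_mul continuous_velocityAmplitude (m := 1)
    (fun y => by simp [norm_smul, norm_direction, abs_of_nonneg (weight_nonneg y)]) k

theorem contDiff_planarPotential : ContDiff ℝ 2 planarPotential :=
  contDiff_oscIntegral (n := 2) continuous_phase continuous_weight
    (fun k _ => integrable_potentialAmplitude k) _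

theorem contDiff_planarPressure : ContDiff ℝ 1 planarPressure :=
  contDiff_oscIntegral (n := 1) continuous_phase continuous_pressureAmplitude
    (fun k _ => integrable_pressureAmplitude k) _

theorem contDiff_planarVelocity : ContDiff ℝ 1 planarVelocity :=
  contDiff_oscIntegral (n := 1) continuous_phase continuous_velocityAmplitude
    (fun k _ => integrable_velocityAmplitude k) _

theorem hasFDerivAt_planarPotential (z : ℝ × EuclideanSpace ℝ (Fin 2)) :
    HasFDerivAt planarPotential
      (oscIntegral polarMeasure phase 0 (fun y => (phase y).smulRight (weight y)) z) z := by
  have := hasFDerivAt_oscIntegral continuous_phase continuous_weight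
    (by simpa using integrable_potentialAmplitude 0)
    (by simpa using integrable_potentialAmplitude 1) (-(Real.pi / 2)) z
  rwa [neg_add_cancel] at this

theorem hasFDerivAt_planarPressure (z : ℝ × EuclideanSpace ℝ (Fin 2)) :
    HasFDerivAt planarPressure
      (oscIntegral polarMeasure phase (0 + Real.pi / 2)
        (fun y => (phase y).smulRight (y.1 * weight y)) z) z :=
  hasFDerivAt_oscIntegral continuous_phase continuous_pressureAmplitude
    (by simpa using integrable_pressureAmplitude 0)
    (by simpa using integrable_pressureAmplitude 1) 0 z

theorem hasFDerivAt_planarVelocity (z : ℝ × EuclideanSpace ℝ (Fin 2)) :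
    HasFDerivAt planarVelocity
      (oscIntegral polarMeasure phase (0 + Real.pi / 2)
        (fun y => (phase y).smulRight ((-(y.1 * weight y)) • direction y)) z) z :=
  hasFDerivAt_oscIntegral continuous_phase continuous_velocityAmplitude
    (by simpa using integrable_velocityAmplitude 0)
    (by simpa using integrable_velocityAmplitude 1) 0 z

end PlaneWaves

/-! ### The acoustic equations in the plane. -/

section PlanarSystem

theorem integrable_pressureDerivative (z : ℝ × EuclideanSpace ℝ (Fin 2)) :
    Integrable (fun y => Real.cos (phase y z + (0 + Real.pi / 2)) •
      (phase y).smulRight (y.1 * weight y)) polarMeasure :=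
  integrable_oscIntegrand continuous_phase
    (continuous_smulRight continuous_phase continuous_pressureAmplitude)
    (by simpa [ContinuousLinearMap.norm_smulRight_apply] using integrable_pressureAmplitude 1) _ z

theorem integrable_velocityDerivative (z : ℝ × EuclideanSpace ℝ (Fin 2)) :
    Integrable (fun y => Real.cos (phase y z + (0 + Real.pi / 2)) •
      (phase y).smulRight ((-(y.1 * weight y)) • direction y)) polarMeasure :=
  integrable_oscIntegrand continuous_phase
    (continuous_smulRight continuous_phase continuous_velocityAmplitude)
    (by simpa [ContinuousLinearMap.norm_smulRight_apply] using integrable_velocityAmplitude 1) _ z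

theorem hasDerivAt_prodMk_const {F : Type} [NormedAddCommGroup F] [NormedSpace ℝ F] (t : ℝ)
    (x : F) : HasDerivAt (fun s : ℝ => (s, x)) ((1 : ℝ), (0 : F)) t :=
  (hasDerivAt_id t).prodMk (hasDerivAt_const t x)

theorem deriv_planarPressure (t : ℝ) (x : EuclideanSpace ℝ (Fin 2)) :
    deriv (fun s => planarPressure (s, x)) t =
      oscIntegral polarMeasure phase (0 + Real.pi / 2)
        (fun y => (phase y).smulRight (y.1 * weight y)) (t, x) (1, 0) :=
  ((hasFDerivAt_planarPressure (t, x)).comp_hasDerivAt t (hasDerivAt_prodMk_const t x)).deriv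

theorem deriv_planarVelocity (t : ℝ) (x : EuclideanSpace ℝ (Fin 2)) :
    deriv (fun s => planarVelocity (s, x)) t =
      oscIntegral polarMeasure phase (0 + Real.pi / 2)
        (fun y => (phase y).smulRight ((-(y.1 * weight y)) • direction y)) (t, x) (1, 0) :=
  ((hasFDerivAt_planarVelocity (t, x)).comp_hasDerivAt t (hasDerivAt_prodMk_const t x)).deriv

theorem fderiv_planarPressure (t : ℝ) (x v : EuclideanSpace ℝ (Fin 2)) :
    fderiv ℝ (fun x => planarPressure (t, x)) x v =
      oscIntegral polarMeasure phase (0 + Real.pi / 2)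
        (fun y => (phase y).smulRight (y.1 * weight y)) (t, x) (0, v) := by
  have h := ((hasFDerivAt_planarPressure (t, x)).comp x (hasFDerivAt_prodMk_right t x)).fderiv
  exact congr($h v)

theorem fderiv_planarVelocity (t : ℝ) (x v : EuclideanSpace ℝ (Fin 2)) :
    fderiv ℝ (fun x => planarVelocity (t, x)) x v =
      oscIntegral polarMeasure phase (0 + Real.pi / 2)
        (fun y => (phase y).smulRight ((-(y.1 * weight y)) • direction y)) (t, x) (0, v) := by
  have h := ((hasFDerivAt_planarVelocity (t, x)).comp x (hasFDerivAt_prodMk_right t x)).fderiv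
  exact congr($h v)

theorem planar_mass_eq (t : ℝ) (x : EuclideanSpace ℝ (Fin 2)) :
    deriv (fun s => planarPressure (s, x)) t
      + ∑ i : Fin 2, (fderiv ℝ (fun x => planarVelocity (t, x)) x
          (EuclideanSpace.single i 1)) i = 0 := by
  -- Entries of the derivatives are continuous linear functionals, so they pass under the integral
  -- and the equation only has to be checked for a single plane wave.
  let P : (ℝ × EuclideanSpace ℝ (Fin 2) →L[ℝ] ℝ) →L[ℝ] ℝ := ContinuousLinearMap.apply ℝ ℝ (1, 0)
  let V (i : Fin 2) :
      (ℝ × EuclideanSpace ℝ (Fin 2) →L[ℝ] EuclideanSpace ℝ (Fin 2)) →L[ℝ] ℝ :=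
    (EuclideanSpace.proj i : EuclideanSpace ℝ (Fin 2) →L[ℝ] ℝ).comp
      (ContinuousLinearMap.apply ℝ _ (0, EuclideanSpace.single i 1))
  have hp := integrable_pressureDerivative (t, x)
  have hv := integrable_velocityDerivative (t, x)
  simp only [fderiv_planarVelocity, deriv_planarPressure, Fin.sum_univ_two]
  change P (∫ y, _ ∂_) + (V 0 (∫ y, _ ∂_) + V 1 (∫ y, _ ∂_)) = 0
  rw [← P.integral_comp_comm hp, ← (V 0).integral_comp_comm hv, ← (V 1).integral_comp_comm hv,
    ← integral_add' ((V 0).integrable_comp hv) ((V 1).integrable_comp hv),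
    ← integral_add' (P.integrable_comp hp)
      (((V 0).integrable_comp hv).add ((V 1).integrable_comp hv))]
  refine integral_eq_zero_of_ae (.of_forall fun y => ?_)
  simp only [Pi.add_apply, P, V, ContinuousLinearMap.apply_apply, smul_apply,
    ContinuousLinearMap.smulRight_apply, ContinuousLinearMap.comp_apply, phase_apply]
  simp [direction]
  -- The contributions of the plane wave cancel because its direction is a unit vector.
  linear_combination (-(Real.cos (y.1 * (t + (Real.sin y.2 * x 0 + Real.cos y.2 * x 1)) +
    Real.pi / 2) * y.1 * y.1 * weight y)) * Real.sin_sq_add_cos_sq y.2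

theorem planar_momentum_eq (t : ℝ) (x : EuclideanSpace ℝ (Fin 2)) :
    deriv (fun s => planarVelocity (s, x)) t + gradient (fun x => planarPressure (t, x)) x = 0 := by
  let P (i : Fin 2) : (ℝ × EuclideanSpace ℝ (Fin 2) →L[ℝ] ℝ) →L[ℝ] ℝ :=
    ContinuousLinearMap.apply ℝ ℝ (0, EuclideanSpace.single i 1)
  let V (i : Fin 2) :
      (ℝ × EuclideanSpace ℝ (Fin 2) →L[ℝ] EuclideanSpace ℝ (Fin 2)) →L[ℝ] ℝ :=
    (EuclideanSpace.proj i : EuclideanSpace ℝ (Fin 2) →L[ℝ] ℝ).comp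
      (ContinuousLinearMap.apply ℝ _ (1, 0))
  have hp := integrable_pressureDerivative (t, x)
  have hv := integrable_velocityDerivative (t, x)
  ext i
  have hgrad : gradient (fun x => planarPressure (t, x)) x i =
      fderiv ℝ (fun x => planarPressure (t, x)) x (EuclideanSpace.single i 1) := by
    rw [gradient, ← InnerProductSpace.toDual_symm_apply, real_inner_comm,
      EuclideanSpace.inner_single_left]
    simp
  rw [PiLp.add_apply, hgrad, fderiv_planarPressure, deriv_planarVelocity]
  change V i (∫ y, _ ∂_) + P i (∫ y, _ ∂_) = 0
  rw [← (P i).integral_comp_comm hp, ← (V i).integral_comp_comm hv,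
    ← integral_add ((V i).integrable_comp hv) ((P i).integrable_comp hp)]
  refine integral_eq_zero_of_ae (.of_forall fun y => ?_)
  simp only [P, V, ContinuousLinearMap.apply_apply, smul_apply,
    ContinuousLinearMap.smulRight_apply, ContinuousLinearMap.comp_apply, phase_apply]
  fin_cases i <;> simp [direction] <;> ring

/-- The time derivative of the potential is the pressure. -/
theorem hasDerivAt_planarPotential (t : ℝ) (x : EuclideanSpace ℝ (Fin 2)) :
    HasDerivAt (fun s => planarPotential (s, x)) (planarPressure (t, x)) t := by
  refine ((hasFDerivAt_planarPotential (t, x)).comp_hasDerivAt t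
    (hasDerivAt_prodMk_const t x)).congr_deriv ?_
  rw [oscIntegral_smulRight_apply continuous_phase continuous_weight
    (by simpa using integrable_potentialAmplitude 1)]
  simp [planarPressure, phase_apply]

/-- The gradient of the potential is minus the velocity. -/
theorem hasFDerivAt_planarPotential_right (t : ℝ) (x : EuclideanSpace ℝ (Fin 2)) :
    HasFDerivAt (fun x => planarPotential (t, x)) (-(innerSL ℝ (planarVelocity (t, x)))) x := by
  refine ((hasFDerivAt_planarPotential (t, x)).comp x
    (hasFDerivAt_prodMk_right t x)).congr_fderiv ?_
  have hv := integrable_oscIntegrand (μ := polarMeasure) continuous_phase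
    continuous_velocityAmplitude (by simpa using integrable_velocityAmplitude 0) 0 (t, x)
  ext v
  simp only [ContinuousLinearMap.comp_apply, ContinuousLinearMap.inr_apply,
    neg_apply, innerSL_apply_apply]
  rw [oscIntegral_smulRight_apply continuous_phase continuous_weight
    (by simpa using integrable_potentialAmplitude 1), real_inner_comm, planarVelocity]
  simp only [oscIntegral]
  rw [← integral_inner hv, ← integral_neg]
  refine integral_congr_ae (.of_forall fun y => ?_)
  simp only [inner_smul_right, phase_apply, direction, PiLp.inner_apply, Fin.sum_univ_two]
  simp only [RCLike.inner_apply, conj_trivial]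
  simp [-mul_eq_mul_left_iff]
  ring

end PlanarSystem

/-! ### Angular averages and Bessel functions. -/

section Bessel

theorem intervalIntegral_eq_zero_of_odd {f : ℝ → ℝ} (hf : ∀ x, f (-x) = -f x) (a : ℝ) :
    ∫ x in -a..a, f x = 0 := by
  have h := intervalIntegral.integral_comp_neg (a := -a) (b := a) f
  simp only [hf, intervalIntegral.integral_neg, neg_neg] at h
  linarith

theorem intervalIntegral_eq_two_mul_of_even {f : ℝ → ℝ} (hc : Continuous f)
    (hf : ∀ x, f (-x) = f x) (a : ℝ) :
    ∫ x in -a..a, f x = 2 * ∫ x in (0 : ℝ)..a, f x := by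
  have h := intervalIntegral.integral_comp_neg (a := 0) (b := a) f
  simp only [hf, neg_zero] at h
  rw [← intervalIntegral.integral_add_adjacent_intervals (b := 0)
    (hc.intervalIntegrable _ _) (hc.intervalIntegrable _ _), ← h]
  ring

theorem integral_Ioo_eq_intervalIntegral (f : ℝ → ℝ) :
    ∫ θ in Ioo (-Real.pi) Real.pi, f θ = ∫ θ in -Real.pi..Real.pi, f θ := by
  rw [intervalIntegral.integral_of_le (by linarith [Real.pi_pos]), integral_Ioc_eq_integral_Ioo]

theorem integral_cos_mul_sin (z : ℝ) :
    ∫ θ in -Real.pi..Real.pi, Real.cos (z * Real.sin θ) = 2 * Real.pi * besselJ 0 z := by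
  rw [intervalIntegral_eq_two_mul_of_even (by fun_prop) (fun x => by simp)]
  simp [besselJ]
  field_simp

theorem integral_sin_mul_sin (z : ℝ) :
    ∫ θ in -Real.pi..Real.pi, Real.sin (z * Real.sin θ) = 0 :=
  intervalIntegral_eq_zero_of_odd (fun x => by simp) _

theorem integral_sin_mul_cos_mul_sin (z : ℝ) :
    ∫ θ in -Real.pi..Real.pi, Real.sin θ * Real.cos (z * Real.sin θ) = 0 :=
  intervalIntegral_eq_zero_of_odd (fun x => by simp) _

theorem integral_sin_mul_sin_mul_sin (z : ℝ) :
    ∫ θ in -Real.pi..Real.pi, Real.sin θ * Real.sin (z * Real.sin θ) =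
      2 * Real.pi * besselJ 1 z := by
  -- Expanding cos(θ - z sin θ) in Bessel's integral for J₁ leaves this extra term, which is odd
  -- under θ ↦ π - θ.
  have h0 : ∫ θ in (0 : ℝ)..Real.pi, Real.cos θ * Real.cos (z * Real.sin θ) = 0 := by
    have h := intervalIntegral.integral_comp_sub_left (a := 0) (b := Real.pi)
      (fun θ => Real.cos θ * Real.cos (z * Real.sin θ)) Real.pi
    simp only [Real.cos_pi_sub, Real.sin_pi_sub, neg_mul, intervalIntegral.integral_neg, sub_self,
      sub_zero] at h
    linarith
  rw [intervalIntegral_eq_two_mul_of_even (by fun_prop) (fun x => by simp)]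
  simp only [besselJ, Nat.cast_one, one_mul, Real.cos_sub]
  rw [intervalIntegral.integral_add (Continuous.intervalIntegrable (by fun_prop) _ _)
    (Continuous.intervalIntegrable (by fun_prop) _ _), h0, zero_add, one_div, mul_assoc 2,
    mul_inv_cancel_left₀ Real.pi_ne_zero]

theorem exists_polar_angle (x : EuclideanSpace ℝ (Fin 2)) :
    ∃ β : ℝ, x 0 = ‖x‖ * Real.cos β ∧ x 1 = ‖x‖ * Real.sin β := by
  refine ⟨Complex.arg ⟨x 0, x 1⟩, ?_⟩
  have h : ‖x‖ = ‖(⟨x 0, x 1⟩ : ℂ)‖ := by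
    rw [EuclideanSpace.norm_eq, Complex.norm_def, Complex.normSq_mk]
    simp [pow_two]
  rw [h, Complex.norm_mul_cos_arg, Complex.norm_mul_sin_arg]
  exact ⟨rfl, rfl⟩

/-- Averages of a plane wave over its direction are radial. -/
theorem integral_comp_rotation (g : ℝ → ℝ) (x : EuclideanSpace ℝ (Fin 2)) :
    ∫ θ in -Real.pi..Real.pi, g (Real.sin θ * x 0 + Real.cos θ * x 1) =
      ∫ θ in -Real.pi..Real.pi, g (‖x‖ * Real.sin θ) := by
  obtain ⟨β, h0, h1⟩ := exists_polar_angle x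
  -- With x = ‖x‖(cos β, sin β) the argument of `g` is ‖x‖ sin(θ + β), and an integral over a full
  -- period ignores the shift β.
  have hper : Function.Periodic (fun θ => g (‖x‖ * Real.sin θ)) (2 * Real.pi) := fun θ => by
    simp
  have h := intervalIntegral.integral_comp_add_right (a := -Real.pi) (b := Real.pi)
    (fun θ => g (‖x‖ * Real.sin θ)) β
  have h' := hper.intervalIntegral_add_eq (-Real.pi + β) (-Real.pi)
  rw [show -Real.pi + β + 2 * Real.pi = Real.pi + β by ring,
    show -Real.pi + 2 * Real.pi = Real.pi by ring] at h'
  rw [← h', ← h]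
  refine intervalIntegral.integral_congr fun θ _ => ?_
  simp only [Real.sin_add, h0, h1]
  ring_nf

theorem integral_sin_planeWave (ω t : ℝ) (x : EuclideanSpace ℝ (Fin 2)) :
    ∫ θ in -Real.pi..Real.pi, Real.sin (ω * (t + (Real.sin θ * x 0 + Real.cos θ * x 1))) =
      2 * Real.pi * (besselJ 0 (‖x‖ * ω) * Real.sin (t * ω)) := by
  rw [integral_comp_rotation (fun s => Real.sin (ω * (t + s)))]
  have h (θ : ℝ) : Real.sin (ω * (t + ‖x‖ * Real.sin θ)) =
      Real.sin (t * ω) * Real.cos ((‖x‖ * ω) * Real.sin θ) +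
        Real.cos (t * ω) * Real.sin ((‖x‖ * ω) * Real.sin θ) := by
    rw [← Real.sin_add]
    ring_nf
  simp only [h]
  rw [intervalIntegral.integral_add (Continuous.intervalIntegrable (by fun_prop) _ _)
    (Continuous.intervalIntegrable (by fun_prop) _ _), intervalIntegral.integral_const_mul,
    intervalIntegral.integral_const_mul, integral_cos_mul_sin, integral_sin_mul_sin]
  ring

theorem integral_cos_planeWave (ω t : ℝ) (x : EuclideanSpace ℝ (Fin 2)) :
    ∫ θ in -Real.pi..Real.pi, Real.cos (ω * (t + (Real.sin θ * x 0 + Real.cos θ * x 1))) =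
      2 * Real.pi * (besselJ 0 (‖x‖ * ω) * Real.cos (t * ω)) := by
  rw [integral_comp_rotation (fun s => Real.cos (ω * (t + s)))]
  have h (θ : ℝ) : Real.cos (ω * (t + ‖x‖ * Real.sin θ)) =
      Real.cos (t * ω) * Real.cos ((‖x‖ * ω) * Real.sin θ) -
        Real.sin (t * ω) * Real.sin ((‖x‖ * ω) * Real.sin θ) := by
    rw [← Real.cos_add]
    ring_nf
  simp only [h]
  rw [intervalIntegral.integral_sub (Continuous.intervalIntegrable (by fun_prop) _ _)
    (Continuous.intervalIntegrable (by fun_prop) _ _), intervalIntegral.integral_const_mul,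
    intervalIntegral.integral_const_mul, integral_cos_mul_sin, integral_sin_mul_sin]
  ring

theorem integral_sin_mul_cos_planeWave (ω t r : ℝ) :
    ∫ θ in -Real.pi..Real.pi, Real.sin θ * Real.cos (ω * (t + Real.sin θ * r)) =
      -(2 * Real.pi * (besselJ 1 (r * ω) * Real.sin (t * ω))) := by
  have h (θ : ℝ) : Real.sin θ * Real.cos (ω * (t + Real.sin θ * r)) =
      Real.cos (t * ω) * (Real.sin θ * Real.cos ((r * ω) * Real.sin θ)) -
        Real.sin (t * ω) * (Real.sin θ * Real.sin ((r * ω) * Real.sin θ)) := by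
    rw [show ω * (t + Real.sin θ * r) = t * ω + (r * ω) * Real.sin θ by ring, Real.cos_add]
    ring
  simp only [h]
  rw [intervalIntegral.integral_sub (Continuous.intervalIntegrable (by fun_prop) _ _)
    (Continuous.intervalIntegrable (by fun_prop) _ _), intervalIntegral.integral_const_mul,
    intervalIntegral.integral_const_mul, integral_sin_mul_cos_mul_sin, integral_sin_mul_sin_mul_sin]
  ring

/-- Integration over the polar measure as an iterated integral. -/
theorem integral_polarMeasure {f : ℝ × ℝ → ℝ} (hf : Integrable f polarMeasure) {g : ℝ → ℝ}
    (hg : ∀ ω, ∫ θ in -Real.pi..Real.pi, f (ω, θ) = g ω) :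
    IntegrableOn g (Ioi 0) ∧ ∫ y, f y ∂polarMeasure = ∫ ω in Ioi (0 : ℝ), g ω := by
  rw [polarMeasure_eq_prod] at hf ⊢
  have h1 := hf.integral_prod_left
  rw [integral_prod f hf]
  simp only [integral_Ioo_eq_intervalIntegral, hg] at h1 ⊢
  exact ⟨h1, trivial⟩

theorem planarPotential_eq_integral (t : ℝ) (x : EuclideanSpace ℝ (Fin 2)) :
    IntegrableOn (fun ω : ℝ => Real.exp (-ω ^ 2 / 2) *
      (besselJ 0 (‖x‖ * ω) * Real.sin (t * ω))) (Ioi 0) ∧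
    planarPotential (t, x) = ∫ ω in Ioi (0 : ℝ), Real.exp (-ω ^ 2 / 2) *
      (besselJ 0 (‖x‖ * ω) * Real.sin (t * ω)) := by
  refine integral_polarMeasure (integrable_oscIntegrand continuous_phase continuous_weight
    (by simpa using integrable_potentialAmplitude 0) _ _) fun ω => ?_
  simp only [phase_apply, weight, smul_eq_mul, ← sub_eq_add_neg, Real.cos_sub_pi_div_two]
  rw [intervalIntegral.integral_mul_const, integral_sin_planeWave]
  field_simp

theorem planarPressure_eq_integral (t : ℝ) (x : EuclideanSpace ℝ (Fin 2)) :
    IntegrableOn (fun ω : ℝ => ω * Real.exp (-ω ^ 2 / 2) *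
      (besselJ 0 (‖x‖ * ω) * Real.cos (t * ω))) (Ioi 0) ∧
    planarPressure (t, x) = ∫ ω in Ioi (0 : ℝ), ω * Real.exp (-ω ^ 2 / 2) *
      (besselJ 0 (‖x‖ * ω) * Real.cos (t * ω)) := by
  refine integral_polarMeasure (integrable_oscIntegrand continuous_phase
    continuous_pressureAmplitude (by simpa using integrable_pressureAmplitude 0) _ _) fun ω => ?_
  simp only [phase_apply, weight, smul_eq_mul, add_zero]
  rw [intervalIntegral.integral_mul_const, integral_cos_planeWave]
  field_simp

theorem planarVelocity_eq_integral (t r : ℝ) :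
    IntegrableOn (fun ω : ℝ => ω * Real.exp (-ω ^ 2 / 2) *
      (besselJ 1 (r * ω) * Real.sin (t * ω))) (Ioi 0) ∧
    planarVelocity (t, EuclideanSpace.single 0 r) 0 =
      ∫ ω in Ioi (0 : ℝ), ω * Real.exp (-ω ^ 2 / 2) *
        (besselJ 1 (r * ω) * Real.sin (t * ω)) := by
  let L : EuclideanSpace ℝ (Fin 2) →L[ℝ] ℝ := EuclideanSpace.proj 0
  have hv := integrable_oscIntegrand (μ := polarMeasure) continuous_phase
    continuous_velocityAmplitude (by simpa using integrable_velocityAmplitude 0) 0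
    (t, EuclideanSpace.single 0 r)
  have h := integral_polarMeasure (L.integrable_comp hv)
    (g := fun ω => ω * Real.exp (-ω ^ 2 / 2) * (besselJ 1 (r * ω) * Real.sin (t * ω)))
    fun ω => ?_
  · rw [L.integral_comp_comm hv] at h
    exact h
  · have (θ : ℝ) : L (Real.cos (phase (ω, θ) (t, EuclideanSpace.single 0 r) + 0) •
        (-((ω, θ).1 * weight (ω, θ))) • direction (ω, θ)) =
        -(ω * weight (ω, 0)) * (Real.sin θ * Real.cos (ω * (t + Real.sin θ * r))) := by
      simp [L, phase_apply, direction, weight, -mul_eq_mul_left_iff]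
      ring
    simp only [this]
    rw [intervalIntegral.integral_const_mul, integral_sin_mul_cos_planeWave, weight]
    field_simp

end Bessel

/-! ### The initial pressure. -/

section InitialValue

open Complex in
theorem integral_gaussian_mul_cexp (a : ℝ) :
    ∫ s : ℝ, cexp (I * a * s) * cexp (-s ^ 2 / 2) =
      (Real.sqrt (2 * Real.pi) * Real.exp (-a ^ 2 / 2) : ℝ) := by
  have h := fourierIntegral_gaussian (b := 1 / 2) (by norm_num) (a : ℂ)
  have h2 : ((Real.pi : ℂ) / (1 / 2)) ^ (1 / 2 : ℂ) = (Real.sqrt (2 * Real.pi) : ℝ) := by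
    rw [Real.sqrt_eq_rpow, ofReal_cpow (by positivity)]
    congr 1 <;> push_cast <;> ring
  rw [h2] at h
  push_cast at h ⊢
  rw [show -(a : ℂ) ^ 2 / 2 = -(a : ℂ) ^ 2 / (4 * (1 / 2)) by ring, ← h]
  refine integral_congr_ae (.of_forall fun s => ?_)
  simp only
  congr 2
  ring

open Complex in
theorem planarPressure_zero (x : EuclideanSpace ℝ (Fin 2)) :
    planarPressure (0, x) = Real.exp (-‖x‖ ^ 2 / 2) := by
  -- The coordinates `x 1` and `x 0` appear in swapped order because `direction` is (sin θ, cos θ),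
  -- whereas polar coordinates give k = (ω cos θ, ω sin θ).
  have hpolar := integral_comp_polarCoord_symm (fun k : ℝ × ℝ =>
    (cexp (I * x 1 * k.1) * cexp (-k.1 ^ 2 / 2)) * (cexp (I * x 0 * k.2) * cexp (-k.2 ^ 2 / 2)))
  rw [Measure.volume_eq_prod,
    integral_prod_mul (fun s : ℝ => cexp (I * x 1 * s) * cexp (-s ^ 2 / 2))
      (fun s : ℝ => cexp (I * x 0 * s) * cexp (-s ^ 2 / 2)),
    integral_gaussian_mul_cexp, integral_gaussian_mul_cexp, ← ofReal_mul] at hpolar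
  let f : ℝ × ℝ → ℂ := fun y =>
    (2 * Real.pi : ℝ) * ((y.1 * weight y : ℝ) * cexp (I * (phase y (0, x) : ℝ)))
  have hf : ∀ y : ℝ × ℝ, y.1 • ((cexp (I * x 1 * (polarCoord.symm y).1) *
      cexp (-(polarCoord.symm y).1 ^ 2 / 2)) * (cexp (I * x 0 * (polarCoord.symm y).2) *
      cexp (-(polarCoord.symm y).2 ^ 2 / 2))) = f y := fun y => by
    simp only [f, polarCoord_symm_apply, weight, phase_apply, real_smul]
    push_cast
    rw [← Complex.exp_add, ← Complex.exp_add, ← Complex.exp_add]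
    have h2 : (2 * Real.pi : ℂ) ≠ 0 := by simp [Real.pi_ne_zero]
    rw [show ∀ A B : ℂ, 2 * (Real.pi : ℂ) * (y.1 * (1 / (2 * Real.pi) * A) * B) =
      y.1 * (A * B) by intro A B; field_simp, ← Complex.exp_add]
    congr 2
    linear_combination (-(y.1 : ℂ) ^ 2 / 2) * Complex.sin_sq_add_cos_sq y.2
  have hfi : Integrable f polarMeasure := by
    have h0 : Integrable (fun y : ℝ × ℝ => ‖y.1 * weight y‖) polarMeasure := by
      simpa using integrable_pressureAmplitude 0
    have hc : Continuous f := by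
      have := continuous_phase
      have := continuous_weight
      fun_prop
    refine (h0.const_mul (2 * Real.pi)).mono' hc.aestronglyMeasurable (.of_forall fun y => ?_)
    simp only [f, norm_mul, norm_real, mul_comm I, norm_exp_ofReal_mul_I, mul_one, Real.norm_eq_abs]
    rw [abs_of_pos Real.pi_pos, abs_two]
  simp only [hf] at hpolar
  have hre := congrArg reCLM hpolar
  change reCLM (∫ y, f y ∂polarMeasure) = _ at hre
  rw [← reCLM.integral_comp_comm hfi] at hre
  have hfre (y : ℝ × ℝ) : reCLM (f y) =
      2 * Real.pi * (Real.cos (phase y (0, x) + 0) • (y.1 * weight y)) := by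
    simp only [f, reCLM_apply, re_ofReal_mul, mul_comm I, exp_ofReal_mul_I_re, add_zero, smul_eq_mul]
    ring
  simp only [hfre, reCLM_apply, ofReal_re] at hre
  rw [integral_const_mul] at hre
  have hpi : (0 : ℝ) < 2 * Real.pi := by positivity
  have hexp : Real.exp (-‖x‖ ^ 2 / 2) = Real.exp (-x 1 ^ 2 / 2) * Real.exp (-x 0 ^ 2 / 2) := by
    rw [EuclideanSpace.norm_sq_eq, ← Real.exp_add]
    simp
    ring
  rw [hexp, ← mul_right_inj' hpi.ne', planarPressure, oscIntegral, hre]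
  nth_rewrite 3 [← Real.mul_self_sqrt hpi.le]
  ring

end InitialValue

/-! ### The Laplace transform of J₀ by Cauchy's formula. -/

section LaplaceTransform

open Complex

/-- With z = e^{iθ}, z times the denominator factors as (z + α)·((a + b)²/4)(1 - αz) for α = -i(a -
b)/(a + b). The hypothesis says |α| < 1, so Cauchy's formula at the only pole -α in the disc gives
the value, since (a + b)²(1 + α²)/4 = ab. Stating everything in terms of `a` and `b` avoids choosing
a square root of a²b². -/
theorem circleAverage_inv_eq {a b : ℂ} (hab : ‖a - b‖ < ‖a + b‖) :
    ∫ θ in -Real.pi..Real.pi, ((a ^ 2 + b ^ 2) / 2 - (a ^ 2 - b ^ 2) / 2 * (Real.sin θ : ℝ))⁻¹ =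
      2 * Real.pi / (a * b) := by
  have hs : a + b ≠ 0 := norm_pos_iff.1 ((norm_nonneg _).trans_lt hab)
  set α : ℂ := -I * ((a - b) / (a + b)) with hα
  have hα1 : ‖α‖ < 1 := by
    rw [hα, norm_mul, norm_div, norm_neg, norm_I, one_mul, div_lt_one (norm_pos_iff.2 hs)]
    exact hab
  have hα2 : α * (a + b) = -I * (a - b) := by
    rw [hα]
    field_simp
  have hne : ∀ z ∈ Metric.closedBall (0 : ℂ) 1, (a + b) ^ 2 / 4 * (1 - α * z) ≠ 0 := by
    intro z hz
    refine mul_ne_zero (by simpa using hs) fun h => ?_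
    have h1 : α * z = 1 := (sub_eq_zero.1 h).symm
    have h2 : ‖α * z‖ < 1 := by
      rw [norm_mul]
      have hz' : ‖z‖ ≤ 1 := by simpa using hz
      nlinarith [norm_nonneg α, norm_nonneg z]
    rw [h1, norm_one] at h2
    exact lt_irrefl _ h2
  have hd : DifferentiableOn ℂ (fun z => ((a + b) ^ 2 / 4 * (1 - α * z))⁻¹)
      (Metric.closedBall 0 1) := by
    refine DifferentiableOn.inv (by fun_prop) hne
  have hC := hd.circleIntegral_sub_inv_smul (w := -α) (by simpa using hα1)
  have hval : (a + b) ^ 2 / 4 * (1 - α * -α) = a * b := by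
    linear_combination (1 / 4) * (α * (a + b) + -I * (a - b)) * hα2 + (a - b) ^ 2 / 4 * I_sq
  simp only [circleIntegral, deriv_circleMap, smul_eq_mul, hval] at hC
  have hper : Function.Periodic (fun θ : ℝ =>
      ((a ^ 2 + b ^ 2) / 2 - (a ^ 2 - b ^ 2) / 2 * (Real.sin θ : ℝ))⁻¹) (2 * Real.pi) := fun θ => by
    simp only [Real.sin_add_two_pi]
  have hshift := hper.intervalIntegral_add_eq (-Real.pi) 0
  rw [show -Real.pi + 2 * Real.pi = Real.pi by ring, zero_add] at hshift
  rw [hshift]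
  have hpt (θ : ℝ) : circleMap 0 1 θ * I *
      ((circleMap 0 1 θ - -α)⁻¹ * ((a + b) ^ 2 / 4 * (1 - α * circleMap 0 1 θ))⁻¹) =
      I * ((a ^ 2 + b ^ 2) / 2 - (a ^ 2 - b ^ 2) / 2 * (Real.sin θ : ℝ))⁻¹ := by
    have hz : circleMap 0 1 θ = cexp (θ * I) := by simp [circleMap]
    have hz0 : cexp (θ * I) ≠ 0 := Complex.exp_ne_zero _
    have hsin : ((Real.sin θ : ℝ) : ℂ) * cexp (θ * I) = (1 - cexp (θ * I) ^ 2) * I / 2 := by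
      rw [ofReal_sin, Complex.sin, neg_mul, Complex.exp_neg]
      field_simp
    have hden : (cexp (θ * I) - -α) * ((a + b) ^ 2 / 4 * (1 - α * cexp (θ * I))) =
        cexp (θ * I) *
          ((a ^ 2 + b ^ 2) / 2 - (a ^ 2 - b ^ 2) / 2 * (Real.sin θ : ℝ)) := by
      set z := cexp (θ * I)
      linear_combination ((1 - z ^ 2) * (a + b) / 4 -
        z * (α * (a + b) + -I * (a - b)) / 4) * hα2 + (a ^ 2 - b ^ 2) / 2 * hsin
        - z * (a - b) ^ 2 / 4 * I_sq
    rw [hz, ← mul_inv, hden, mul_inv]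
    field_simp
  simp only [hpt] at hC
  rw [intervalIntegral.integral_const_mul] at hC
  rw [← mul_right_inj' I_ne_zero, hC]
  ring

/-- The squared norms differ by 4 Re(a b̄). -/
theorem norm_sub_lt_norm_add_of_re_pos {a b : ℂ} (h : 0 < (a * (starRingEnd ℂ) b).re) :
    ‖a - b‖ < ‖a + b‖ := by
  rw [← sq_lt_sq₀ (norm_nonneg _) (norm_nonneg _), Complex.sq_norm, Complex.sq_norm,
    normSq_sub, normSq_add]
  linarith

theorem norm_exp_sub_lt {u v : ℂ} (h : |u.im - v.im| < Real.pi / 2) :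
    ‖cexp u - cexp v‖ < ‖cexp u + cexp v‖ := by
  refine norm_sub_lt_norm_add_of_re_pos ?_
  rw [← Complex.exp_conj, ← Complex.exp_add, Complex.exp_re]
  simp only [add_im, conj_im, ← sub_eq_add_neg]
  exact mul_pos (Real.exp_pos _) (Real.cos_pos_of_mem_Ioo (abs_lt.1 h))

theorem ofReal_besselJ_zero (z : ℝ) :
    (besselJ 0 z : ℂ) =
      (2 * Real.pi)⁻¹ * ∫ θ in -Real.pi..Real.pi, cexp (I * (z * Real.sin θ : ℝ)) := by
  have hpt (θ : ℝ) : cexp (I * (z * Real.sin θ : ℝ)) =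
      (Real.cos (z * Real.sin θ) : ℝ) + (Real.sin (z * Real.sin θ) : ℝ) * I := by
    rw [mul_comm, exp_mul_I, ofReal_cos, ofReal_sin]
  simp only [hpt]
  rw [intervalIntegral.integral_add (Continuous.intervalIntegrable (by fun_prop) _ _)
    (Continuous.intervalIntegrable (by fun_prop) _ _), intervalIntegral.integral_mul_const,
    intervalIntegral.integral_ofReal, intervalIntegral.integral_ofReal, integral_cos_mul_sin,
    integral_sin_mul_sin]
  push_cast
  have : (Real.pi : ℂ) ≠ 0 := by simp [Real.pi_ne_zero]
  field_simp
  simp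

theorem continuous_besselJ_zero : Continuous (besselJ 0) := by
  unfold besselJ
  refine continuous_const.mul ?_
  exact intervalIntegral.continuous_parametric_intervalIntegral_of_continuous'
    (f := fun x θ => Real.cos ((0 : ℕ) * θ - x * Real.sin θ)) (by fun_prop) _ _

theorem abs_besselJ_zero_le (z : ℝ) : |besselJ 0 z| ≤ 1 := by
  have h := intervalIntegral.norm_integral_le_of_norm_le_const (a := 0) (b := Real.pi) (C := 1)
    (f := fun θ => Real.cos ((0 : ℕ) * θ - z * Real.sin θ)) fun θ _ => Real.abs_cos_le_one _
  rw [sub_zero, one_mul, abs_of_pos Real.pi_pos, Real.norm_eq_abs] at h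
  rw [besselJ, abs_mul, abs_of_pos (by positivity), one_div, inv_mul_le_one₀ Real.pi_pos]
  exact h

/-- The Laplace transform of `J₀`. -/
theorem laplace_besselJ_zero (r : ℝ) {p : ℂ} (hp : 0 < p.re) :
    ∫ ω in Ioi (0 : ℝ), cexp (-p * ω) * besselJ 0 (r * ω) =
      cexp (-((log (p + I * r) + log (p - I * r)) / 2)) := by
  have hdecay : Integrable (fun ω : ℝ => cexp (-p * ω)) (volume.restrict (Ioi 0)) :=
    integrableOn_exp_mul_complex_Ioi (by simpa using hp) 0
  have hprod : Integrable (Function.uncurry fun (ω θ : ℝ) =>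
      cexp (-p * ω) * cexp (I * (r * ω * Real.sin θ : ℝ)))
      ((volume.restrict (Ioi 0)).prod (volume.restrict (Ioc (-Real.pi) Real.pi))) := by
    refine (hdecay.mul_prod (integrable_const (1 : ℂ))).mono
      (Continuous.aestronglyMeasurable ?_) (.of_forall fun y => ?_)
    · unfold Function.uncurry
      fun_prop
    · simp only [Function.uncurry, norm_mul, mul_comm I, norm_exp_ofReal_mul_I, norm_one]
      rfl
  have hpi : -Real.pi ≤ Real.pi := by linarith [Real.pi_pos]
  have hswap := integral_integral_swap hprod
  have hinner (θ : ℝ) : ∫ ω in Ioi (0 : ℝ), cexp (-p * ω) * cexp (I * (r * ω * Real.sin θ : ℝ)) =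
      (p - I * r * (Real.sin θ : ℝ))⁻¹ := by
    have h := integral_exp_mul_complex_Ioi (a := -(p - I * r * (Real.sin θ : ℝ))) (by simpa using hp) 0
    simp only [ofReal_zero, mul_zero, Complex.exp_zero, neg_div_neg_eq, one_div] at h
    rw [← h]
    refine integral_congr_ae (.of_forall fun ω => ?_)
    simp only
    rw [← Complex.exp_add]
    congr 1
    push_cast
    ring
  simp only [hinner] at hswap
  set a := cexp (log (p + I * r) / 2) with ha
  set b := cexp (log (p - I * r) / 2) with hb
  have hp1 : 0 < (p + I * r).re := by simpa using hp
  have hp2 : 0 < (p - I * r).re := by simpa using hp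
  have ha2 : a ^ 2 = p + I * r := by
    rw [ha, ← Complex.exp_nat_mul, Nat.cast_two, mul_div_cancel₀ _ two_ne_zero, exp_log]
    exact fun h => hp1.ne' (by rw [h, zero_re])
  have hb2 : b ^ 2 = p - I * r := by
    rw [hb, ← Complex.exp_nat_mul, Nat.cast_two, mul_div_cancel₀ _ two_ne_zero, exp_log]
    exact fun h => hp2.ne' (by rw [h, zero_re])
  -- Since p ± ir lie in the right half-plane, their roots `a` and `b` have arguments in (-π/4,
  -- π/4), which differ by less than π/2.
  have hlt : ‖a - b‖ < ‖a + b‖ := by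
    refine norm_exp_sub_lt ?_
    have h1 := abs_lt.1 (abs_arg_lt_pi_div_two_iff.2 (Or.inl hp1))
    have h2 := abs_lt.1 (abs_arg_lt_pi_div_two_iff.2 (Or.inl hp2))
    have him (z : ℂ) : (log z / 2).im = arg z / 2 := by simp [log_im]
    rw [him, him, abs_lt]
    constructor <;> linarith [h1.1, h1.2, h2.1, h2.2]
  have hcirc := circleAverage_inv_eq hlt
  rw [ha2, hb2, show (p + I * r + (p - I * r)) / 2 = p by ring,
    show (p + I * r - (p - I * r)) / 2 = I * r by ring, intervalIntegral.integral_of_le hpi,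
    ← hswap] at hcirc
  have hJ (ω : ℝ) : cexp (-p * ω) * besselJ 0 (r * ω) = (2 * Real.pi)⁻¹ *
      ∫ θ in Ioc (-Real.pi) Real.pi, cexp (-p * ω) * cexp (I * (r * ω * Real.sin θ : ℝ)) := by
    rw [ofReal_besselJ_zero, integral_const_mul, intervalIntegral.integral_of_le hpi]
    ring
  simp only [hJ]
  rw [integral_const_mul, hcirc, add_div, neg_add, Complex.exp_add, Complex.exp_neg,
    Complex.exp_neg, ← ha, ← hb]
  have : (Real.pi : ℂ) ≠ 0 := by simp [Real.pi_ne_zero]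
  push_cast
  field_simp

end LaplaceTransform

/-! ### Passage to the boundary of the half-plane of convergence. -/

section DampedTransform

open Complex Filter Topology

/-- The singular weight `1 / √|τ² - r²|`. -/
noncomputable def lightConeWeight (r τ : ℝ) : ℝ :=
  |τ - r| ^ (-(1 / 2) : ℝ) * |τ + r| ^ (-(1 / 2) : ℝ)

theorem integrable_of_even {f : ℝ → ℝ} (hf : ∀ x, f (-x) = f x) (h : IntegrableOn f (Ioi 0)) :
    Integrable f := by
  rw [← integrableOn_univ, ← Iic_union_Ioi (a := (0 : ℝ)), integrableOn_union,
    integrableOn_Iic_iff_integrableOn_Iio]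
  refine ⟨?_, h⟩
  rw [← (Measure.measurePreserving_neg (volume : Measure ℝ)).integrableOn_comp_preimage
    (Homeomorph.neg ℝ).measurableEmbedding]
  simpa only [Function.comp_def, neg_preimage, neg_Iio, neg_zero, hf] using h

/-- Completing the square, (s - c)²/2 ≥ s²/4 - c²/2, reduces this to a Gaussian centred at the
singularity. -/
theorem integrable_abs_rpow_mul_gaussian (c : ℝ) :
    Integrable fun s : ℝ => |s| ^ (-(1 / 2) : ℝ) * Real.exp (-(s - c) ^ 2 / 2) := by
  have h0 : Integrable fun s : ℝ => |s| ^ (-(1 / 2) : ℝ) * Real.exp (-(1 / 4) * s ^ 2) := by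
    refine integrable_of_even (fun x => by simp) ?_
    refine (integrableOn_rpow_mul_exp_neg_mul_sq (b := 1 / 4) (by norm_num)
      (s := -(1 / 2)) (by norm_num)).congr_fun (fun s hs => ?_) measurableSet_Ioi
    simp only [abs_of_pos (mem_Ioi.1 hs)]
  refine (h0.mul_const (Real.exp (c ^ 2 / 2))).mono' (Measurable.aestronglyMeasurable
    (by fun_prop)) (.of_forall fun s => ?_)
  rw [Real.norm_of_nonneg (by positivity), mul_assoc, ← Real.exp_add]
  gcongr
  nlinarith [sq_nonneg (s - 2 * c)]

theorem lightConeWeight_nonneg (r τ : ℝ) : 0 ≤ lightConeWeight r τ := by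
  unfold lightConeWeight
  positivity

/-- The singularities at ±r are separated: on either side of τ = 0 one of the two factors is at most
r^{-1/2}. -/
theorem lightConeWeight_le {r : ℝ} (hr : 0 < r) (τ : ℝ) :
    lightConeWeight r τ ≤
      r ^ (-(1 / 2) : ℝ) * (|τ - r| ^ (-(1 / 2) : ℝ) + |τ + r| ^ (-(1 / 2) : ℝ)) := by
  have key : ∀ x : ℝ, r ≤ x → x ^ (-(1 / 2) : ℝ) ≤ r ^ (-(1 / 2) : ℝ) := fun x hx =>
    Real.rpow_le_rpow_of_nonpos hr hx (by norm_num)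
  have hm : 0 ≤ |τ - r| ^ (-(1 / 2) : ℝ) := by positivity
  have hp : 0 ≤ |τ + r| ^ (-(1 / 2) : ℝ) := by positivity
  have h0 : 0 ≤ r ^ (-(1 / 2) : ℝ) := by positivity
  unfold lightConeWeight
  rcases le_total 0 τ with h | h
  · have := key |τ + r| (by rw [abs_of_pos (by linarith)]; linarith)
    nlinarith [mul_nonneg h0 hp]
  · have := key |τ - r| (by rw [abs_of_neg (by linarith)]; linarith)
    nlinarith [mul_nonneg h0 hm]

theorem measurable_lightConeWeight (r : ℝ) : Measurable (lightConeWeight r) := by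
  unfold lightConeWeight
  fun_prop

theorem integrable_gaussian_mul_lightConeWeight {r : ℝ} (hr : 0 < r) (t : ℝ) :
    Integrable fun τ : ℝ => Real.exp (-(τ - t) ^ 2 / 2) * lightConeWeight r τ := by
  have h1 := (integrable_abs_rpow_mul_gaussian (t - r)).comp_sub_right r
  have h2 := (integrable_abs_rpow_mul_gaussian (t + r)).comp_add_right r
  refine ((h1.add h2).const_mul (r ^ (-(1 / 2) : ℝ))).mono'
    (((by fun_prop : Measurable fun τ : ℝ => Real.exp (-(τ - t) ^ 2 / 2)).mul
      (measurable_lightConeWeight r)).aestronglyMeasurable) (.of_forall fun τ => ?_)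
  rw [Real.norm_of_nonneg (mul_nonneg (Real.exp_pos _).le (lightConeWeight_nonneg r τ))]
  calc _ ≤ Real.exp (-(τ - t) ^ 2 / 2) * (r ^ (-(1 / 2) : ℝ) *
        (|τ - r| ^ (-(1 / 2) : ℝ) + |τ + r| ^ (-(1 / 2) : ℝ))) := by
        gcongr
        exact lightConeWeight_le hr τ
    _ = _ := by
        simp only [Pi.add_apply, sub_sub_sub_cancel_right, add_sub_add_right_eq_sub]
        ring

/-- The Laplace transform of `J₀(r ·)`, that is `1 / √(p² + r²)` on `0 ≤ re p`. -/
noncomputable def besselTransform (r : ℝ) (p : ℂ) : ℂ :=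
  cexp (-((log (p + I * r) + log (p - I * r)) / 2))

theorem norm_exp_neg_log_div_two {u : ℂ} (hu : u ≠ 0) :
    ‖cexp (-(log u / 2))‖ = ‖u‖ ^ (-(1 / 2) : ℝ) := by
  rw [norm_exp, Real.rpow_def_of_pos (norm_pos_iff.2 hu)]
  congr 1
  simp [log_re]
  ring

/-- Discarding the real part δ of each factor gives a bound independent of δ, which is the
dominating function for the limit δ → 0. -/
theorem norm_besselTransform_le {r τ : ℝ} (h1 : τ - r ≠ 0) (h2 : τ + r ≠ 0) (δ : ℝ) :
    ‖besselTransform r (δ - I * τ)‖ ≤ lightConeWeight r τ := by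
  have him1 : |τ - r| ≤ ‖(δ - I * τ + I * r : ℂ)‖ := by
    refine le_of_eq_of_le ?_ (abs_im_le_norm _)
    simp [abs_sub_comm, ← sub_eq_neg_add]
  have him2 : |τ + r| ≤ ‖(δ - I * τ - I * r : ℂ)‖ := by
    refine le_of_eq_of_le ?_ (abs_im_le_norm _)
    rw [← abs_neg]
    congr 1
    simp
    ring
  have p1 := abs_pos.2 h1
  have p2 := abs_pos.2 h2
  rw [besselTransform, add_div, neg_add, Complex.exp_add, norm_mul,
    norm_exp_neg_log_div_two (norm_pos_iff.1 (p1.trans_le him1)),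
    norm_exp_neg_log_div_two (norm_pos_iff.1 (p2.trans_le him2))]
  exact mul_le_mul (Real.rpow_le_rpow_of_nonpos p1 him1 (by norm_num))
    (Real.rpow_le_rpow_of_nonpos p2 him2 (by norm_num)) (by positivity) (by positivity)

theorem measurable_besselTransform (r : ℝ) : Measurable (besselTransform r) := by
  unfold besselTransform
  fun_prop

/-- Keeping two separate logarithms is what makes the limit exist: each argument tends to a nonzero
imaginary number, off the branch cut, whereas p² + r² tends to the negative axis when |τ| > r. -/
theorem tendsto_besselTransform {r τ : ℝ} (h1 : τ - r ≠ 0) (h2 : τ + r ≠ 0) :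
    Tendsto (fun δ : ℝ => besselTransform r (δ - I * τ)) (𝓝[>] 0)
      (𝓝 (besselTransform r (-(I * τ)))) := by
  have hc : ContinuousAt (fun δ : ℝ => besselTransform r (δ - I * τ)) 0 := by
    unfold besselTransform
    refine (ContinuousAt.neg (ContinuousAt.div_const (ContinuousAt.add ?_ ?_) _)).cexp
    · refine ContinuousAt.clog (by fun_prop) (mem_slitPlane_iff.2 (Or.inr ?_))
      simpa [neg_add_eq_zero, sub_eq_zero] using h1
    · refine ContinuousAt.clog (by fun_prop) (mem_slitPlane_iff.2 (Or.inr ?_))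
      intro h
      apply h2
      simp at h
      linarith
  have := hc.tendsto.mono_left (nhdsWithin_le_nhds (s := Ioi 0))
  simpa using this

theorem integral_shifted_gaussian_mul_cexp (t ω : ℝ) :
    ∫ τ : ℝ, (Real.exp (-(τ - t) ^ 2 / 2) : ℂ) * cexp (I * ω * τ) =
      (Real.sqrt (2 * Real.pi) : ℝ) * ((Real.exp (-ω ^ 2 / 2) : ℝ) * cexp (I * t * ω)) := by
  have h := integral_sub_right_eq_self (μ := volume)
    (fun s : ℝ => cexp (I * ω * s) * cexp (-s ^ 2 / 2)) t
  rw [integral_gaussian_mul_cexp] at h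
  rw [show ∀ A B : ℂ, (Real.sqrt (2 * Real.pi) : ℝ) * (A * B) =
    ((Real.sqrt (2 * Real.pi) : ℝ) * A) * B by intro A B; ring, ← ofReal_mul, ← h,
    ← integral_mul_const]
  refine integral_congr_ae (.of_forall fun τ => ?_)
  simp only
  push_cast
  rw [← Complex.exp_add, ← Complex.exp_add, ← Complex.exp_add]
  congr 1
  ring

/-- The Gaussian in ω is a Fourier integral of the Gaussian in τ centred at t. The factor e^{-δω},
with |J₀| ≤ 1, makes the double integral absolutely convergent, so the order of integration can be
exchanged. -/
theorem integral_damped_besselJ_zero (t r : ℝ) {δ : ℝ} (hδ : 0 < δ) :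
    (Real.sqrt (2 * Real.pi) : ℝ) * ∫ ω in Ioi (0 : ℝ), cexp (-(δ - I * t) * ω) *
        (Real.exp (-ω ^ 2 / 2) * besselJ 0 (r * ω) : ℝ) =
      ∫ τ : ℝ, (Real.exp (-(τ - t) ^ 2 / 2) : ℂ) * besselTransform r (δ - I * τ) := by
  have hdecay : Integrable (fun ω : ℝ => cexp (-δ * ω)) (volume.restrict (Ioi 0)) :=
    integrableOn_exp_mul_complex_Ioi (by simpa using hδ) 0
  have hgauss : Integrable (fun τ : ℝ => (Real.exp (-(τ - t) ^ 2 / 2) : ℂ)) := by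
    refine Integrable.ofReal ?_
    have := (integrable_exp_neg_mul_sq (b := 1 / 2) (by norm_num)).comp_sub_right t
    refine this.congr (.of_forall fun τ => ?_)
    simp only
    congr 1
    ring
  have hcJ := continuous_besselJ_zero
  have hprod : Integrable (Function.uncurry fun (ω τ : ℝ) =>
      (Real.exp (-(τ - t) ^ 2 / 2) : ℂ) * (cexp (-(δ - I * τ) * ω) * besselJ 0 (r * ω)))
      ((volume.restrict (Ioi 0)).prod volume) := by
    refine (hdecay.mul_prod hgauss).mono (Continuous.aestronglyMeasurable ?_)
      (.of_forall fun y => ?_)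
    · unfold Function.uncurry
      fun_prop
    · simp only [Function.uncurry, norm_mul, norm_real, Complex.norm_exp, Real.norm_eq_abs]
      have h1 : (-(δ - I * y.2) * y.1 : ℂ).re = (-δ * y.1 : ℂ).re := by simp
      rw [h1, mul_comm]
      gcongr
      exact mul_le_of_le_one_right (Real.exp_pos _).le (abs_besselJ_zero_le _)
  have hswap := integral_integral_swap hprod
  have hright (τ : ℝ) : ∫ ω in Ioi (0 : ℝ), (Real.exp (-(τ - t) ^ 2 / 2) : ℂ) *
      (cexp (-(δ - I * τ) * ω) * besselJ 0 (r * ω)) =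
      (Real.exp (-(τ - t) ^ 2 / 2) : ℂ) * besselTransform r (δ - I * τ) := by
    rw [integral_const_mul, laplace_besselJ_zero r (by simpa using hδ)]
    rfl
  have hleft (ω : ℝ) : ∫ τ : ℝ, (Real.exp (-(τ - t) ^ 2 / 2) : ℂ) *
      (cexp (-(δ - I * τ) * ω) * besselJ 0 (r * ω)) =
      (Real.sqrt (2 * Real.pi) : ℝ) * (cexp (-(δ - I * t) * ω) *
        (Real.exp (-ω ^ 2 / 2) * besselJ 0 (r * ω) : ℝ)) := by
    have h := integral_shifted_gaussian_mul_cexp t ω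
    have hsplit (x : ℝ) : cexp (-(δ - I * x) * ω) = cexp (I * ω * x) * cexp (-δ * ω) := by
      rw [← Complex.exp_add]
      ring_nf
    simp only [hsplit, ← mul_assoc]
    rw [integral_mul_const, integral_mul_const, h]
    push_cast
    ring_nf
  simp only [hright, hleft] at hswap
  rwa [integral_const_mul] at hswap

theorem ae_sub_ne_zero (r : ℝ) : ∀ᵐ τ : ℝ, τ - r ≠ 0 ∧ τ + r ≠ 0 := by
  have h1 := Measure.ae_ne (volume : Measure ℝ) r
  have h2 := Measure.ae_ne (volume : Measure ℝ) (-r)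
  filter_upwards [h1, h2] with τ h1 h2
  exact ⟨sub_ne_zero.2 h1, fun h => h2 (eq_neg_of_add_eq_zero_left h)⟩

theorem integral_besselJ_zero_eq_integral_besselTransform (t : ℝ) {r : ℝ} (hr : 0 < r) :
    (Real.sqrt (2 * Real.pi) : ℝ) * ∫ ω in Ioi (0 : ℝ), cexp (I * t * ω) *
        (Real.exp (-ω ^ 2 / 2) * besselJ 0 (r * ω) : ℝ) =
      ∫ τ : ℝ, (Real.exp (-(τ - t) ^ 2 / 2) : ℂ) * besselTransform r (-(I * τ)) := by
  have hcJ := continuous_besselJ_zero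
  have hL : Tendsto (fun δ : ℝ => ∫ ω in Ioi (0 : ℝ), cexp (-(δ - I * t) * ω) *
        (Real.exp (-ω ^ 2 / 2) * besselJ 0 (r * ω) : ℝ)) (𝓝[>] 0)
      (𝓝 (∫ ω in Ioi (0 : ℝ), cexp (I * t * ω) *
        (Real.exp (-ω ^ 2 / 2) * besselJ 0 (r * ω) : ℝ))) := by
    refine tendsto_integral_filter_of_dominated_convergence
      (fun ω => ω ^ 0 * Real.exp (-ω ^ 2 / 2))
      (.of_forall fun δ => Continuous.aestronglyMeasurable (by fun_prop)) ?_
      (integrable_pow_mul_gaussian 0) (.of_forall fun ω => ?_)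
    · filter_upwards [self_mem_nhdsWithin] with δ hδ
      filter_upwards [self_mem_ae_restrict measurableSet_Ioi] with ω hω
      rw [norm_mul, norm_real, Complex.norm_exp, norm_mul, pow_zero]
      have h1 : Real.exp (-(δ - I * t) * ω : ℂ).re ≤ 1 := by
        simpa using mul_nonneg (le_of_lt hδ) (le_of_lt hω)
      have h2 : ‖Real.exp (-ω ^ 2 / 2)‖ * ‖besselJ 0 (r * ω)‖ ≤ Real.exp (-ω ^ 2 / 2) := by
        rw [Real.norm_of_nonneg (Real.exp_pos _).le]
        exact mul_le_of_le_one_right (Real.exp_pos _).le (abs_besselJ_zero_le _)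
      exact mul_le_mul h1 h2 (by positivity) zero_le_one
    · have hc : Continuous fun δ : ℝ => cexp (-(δ - I * t) * ω) *
          (Real.exp (-ω ^ 2 / 2) * besselJ 0 (r * ω) : ℝ) := by fun_prop
      have := (hc.tendsto 0).mono_left (nhdsWithin_le_nhds (s := Ioi 0))
      simpa using this
  have hR : Tendsto (fun δ : ℝ => ∫ τ : ℝ, (Real.exp (-(τ - t) ^ 2 / 2) : ℂ) *
        besselTransform r (δ - I * τ)) (𝓝[>] 0)
      (𝓝 (∫ τ : ℝ, (Real.exp (-(τ - t) ^ 2 / 2) : ℂ) * besselTransform r (-(I * τ)))) := by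
    have hm := measurable_besselTransform r
    refine tendsto_integral_filter_of_dominated_convergence
      (fun τ => Real.exp (-(τ - t) ^ 2 / 2) * lightConeWeight r τ)
      (.of_forall fun δ => Measurable.aestronglyMeasurable (by fun_prop)) (.of_forall fun δ => ?_)
      (integrable_gaussian_mul_lightConeWeight hr t) ?_
    · filter_upwards [ae_sub_ne_zero r] with τ hτ
      rw [norm_mul, norm_real, Real.norm_of_nonneg (Real.exp_pos _).le]
      gcongr
      exact norm_besselTransform_le hτ.1 hτ.2 δ
    · filter_upwards [ae_sub_ne_zero r] with τ hτ
      exact (tendsto_besselTransform hτ.1 hτ.2).const_mul _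
  refine tendsto_nhds_unique (hL.const_mul _) (hR.congr' ?_)
  filter_upwards [self_mem_nhdsWithin] with δ hδ
  exact (integral_damped_besselJ_zero t r hδ).symm

end DampedTransform

/-! ### Imaginary part of the boundary values, and the Hankel form of W. -/

section HankelForm

open Complex

theorem exp_neg_log_mul_I_div_two {x : ℝ} (hx : 0 < x) :
    cexp (-(log (x * I) / 2)) = (x ^ (-(1 / 2) : ℝ) : ℝ) * cexp (-(Real.pi / 4) * I) := by
  rw [log_ofReal_mul hx I_ne_zero, log_I, Real.rpow_def_of_pos hx, ofReal_exp, ← Complex.exp_add]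
  congr 1
  push_cast
  ring

theorem exp_neg_log_mul_neg_I_div_two {x : ℝ} (hx : 0 < x) :
    cexp (-(log (x * -I) / 2)) = (x ^ (-(1 / 2) : ℝ) : ℝ) * cexp ((Real.pi / 4) * I) := by
  rw [log_ofReal_mul hx (neg_ne_zero.2 I_ne_zero), log_neg_I, Real.rpow_def_of_pos hx, ofReal_exp,
    ← Complex.exp_add]
  congr 1
  push_cast
  ring

theorem lightConeWeight_neg (r τ : ℝ) : lightConeWeight r (-τ) = lightConeWeight r τ := by
  rw [lightConeWeight, lightConeWeight, ← abs_neg (-τ - r), ← abs_neg (-τ + r), mul_comm]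
  ring_nf

theorem besselTransform_eq_mul (r τ : ℝ) :
    besselTransform r (-(I * τ)) =
      cexp (-(log ((r - τ : ℝ) * I) / 2)) * cexp (-(log ((τ + r : ℝ) * -I) / 2)) := by
  rw [besselTransform, ← Complex.exp_add]
  push_cast
  ring_nf

/-- The two inverse square roots carry phases e^{±iπ/4}. These cancel for |τ| < r, combine to i for
τ > r, and to -i for τ < -r. -/
theorem im_besselTransform {r τ : ℝ} (hr : 0 < r) (h1 : τ - r ≠ 0) (h2 : τ + r ≠ 0) :
    (besselTransform r (-(I * τ))).im =
      (Ioi r).indicator (lightConeWeight r) τ - (Ioi r).indicator (lightConeWeight r) (-τ) := by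
  rw [besselTransform_eq_mul]
  rcases lt_or_gt_of_ne (sub_ne_zero.1 h1) with hlt | hgt
  · rcases lt_or_gt_of_ne h2 with hlt' | hgt'
    · have e2 : ((τ + r : ℝ) * -I : ℂ) = (-(τ + r) : ℝ) * I := by push_cast; ring
      have e3 : ∀ A B : ℂ, A * cexp (-(Real.pi / 4) * I) * (B * cexp (-(Real.pi / 4) * I)) =
          A * B * -I := by
        intro A B
        rw [mul_mul_mul_comm, ← Complex.exp_add,
          show -((Real.pi : ℂ) / 4) * I + -(Real.pi / 4) * I = -Real.pi / 2 * I by ring,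
          exp_neg_pi_div_two_mul_I]
      rw [e2, exp_neg_log_mul_I_div_two (by linarith), exp_neg_log_mul_I_div_two (by linarith), e3,
        ← ofReal_mul, indicator_of_notMem (by simp; linarith), indicator_of_mem (by simp; linarith),
        lightConeWeight_neg, lightConeWeight, abs_of_neg (by linarith), abs_of_neg hlt']
      simp
    · have e3 : ∀ A B : ℂ, A * cexp (-(Real.pi / 4) * I) * (B * cexp ((Real.pi / 4) * I)) =
          A * B := by
        intro A B
        rw [neg_mul, Complex.exp_neg]
        field_simp [Complex.exp_ne_zero]
      rw [exp_neg_log_mul_I_div_two (by linarith), exp_neg_log_mul_neg_I_div_two (by linarith), e3,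
        ← ofReal_mul, indicator_of_notMem (by simp; linarith),
        indicator_of_notMem (by simp; linarith)]
      simp
  · have e1 : ((r - τ : ℝ) * I : ℂ) = (τ - r : ℝ) * -I := by push_cast; ring
    have e3 : ∀ A B : ℂ, A * cexp ((Real.pi / 4) * I) * (B * cexp ((Real.pi / 4) * I)) =
        A * B * I := by
      intro A B
      rw [mul_mul_mul_comm, ← Complex.exp_add,
        show ((Real.pi : ℂ) / 4) * I + (Real.pi / 4) * I = Real.pi / 2 * I by ring,
        exp_pi_div_two_mul_I]
    rw [e1, exp_neg_log_mul_neg_I_div_two (by linarith), exp_neg_log_mul_neg_I_div_two (by linarith),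
      e3, ← ofReal_mul, indicator_of_mem (by simp; linarith), indicator_of_notMem (by simp; linarith),
      lightConeWeight, abs_of_pos (by linarith), abs_of_pos (by linarith)]
    simp

/-- The substitution is τ = r(1 + ξ), for which ξ(ξ + 2) = (τ² - r²)/r². -/
theorem halfPotential_eq_integral (t : ℝ) {r : ℝ} (hr : 0 < r) :
    Real.sqrt (2 * Real.pi) * halfPotential t r =
      ∫ τ in Ioi r, Real.exp (-(τ - t) ^ 2 / 2) * lightConeWeight r τ := by
  have hpi : Real.sqrt (2 * Real.pi) ≠ 0 := by positivity
  rw [halfPotential, one_div, mul_inv_cancel_left₀ hpi]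
  have h1 := (measurePreserving_add_right volume r).setIntegral_preimage_emb
    (measurableEmbedding_addRight r)
    (fun τ => Real.exp (-(τ - t) ^ 2 / 2) * lightConeWeight r τ) (Ioi r)
  rw [← h1, preimage_add_const_Ioi, sub_self]
  have h2 := integral_comp_mul_left_Ioi'
    (fun τ => Real.exp (-(τ + r - t) ^ 2 / 2) * lightConeWeight r (τ + r)) 0 hr
  rw [mul_zero] at h2
  rw [← h2, smul_eq_mul, ← integral_const_mul]
  refine setIntegral_congr_fun measurableSet_Ioi fun ξ hξ => ?_
  have hξ' : 0 < ξ := hξ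
  simp only [halfPotentialIntegrand, lightConeWeight]
  rw [add_sub_cancel_right, abs_of_pos (by positivity), abs_of_pos (by positivity),
    Real.rpow_neg (by positivity), Real.rpow_neg (by positivity), ← Real.sqrt_eq_rpow,
    ← Real.sqrt_eq_rpow, show r * ξ + r + r = r * (ξ + 2) by ring, Real.sqrt_mul hr.le,
    Real.sqrt_mul hr.le, show r * ξ + r - t = r - t + ξ * r by ring]
  have h3 : Real.sqrt r ≠ 0 := by positivity
  field_simp
  rw [Real.sq_sqrt hr.le]

/-- The potential in Hankel form. -/
theorem integral_besselJ_zero_mul_sin (t : ℝ) {r : ℝ} (hr : 0 < r) :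
    ∫ ω in Ioi (0 : ℝ), Real.exp (-ω ^ 2 / 2) * (besselJ 0 (r * ω) * Real.sin (t * ω)) =
      -potential t r := by
  have hcJ := continuous_besselJ_zero
  have h := congrArg imCLM (integral_besselJ_zero_eq_integral_besselTransform t hr)
  have hL : Integrable (fun ω : ℝ => cexp (I * t * ω) *
      (Real.exp (-ω ^ 2 / 2) * besselJ 0 (r * ω) : ℝ)) (volume.restrict (Ioi 0)) := by
    refine (integrable_pow_mul_gaussian 0).mono' (Continuous.aestronglyMeasurable (by fun_prop))
      (.of_forall fun ω => ?_)
    rw [norm_mul, norm_real, Complex.norm_exp, norm_mul, pow_zero,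
      Real.norm_of_nonneg (Real.exp_pos _).le]
    simp only [mul_re, I_re, ofReal_re, zero_mul, I_im, ofReal_im, mul_zero, sub_self, mul_im,
      Real.exp_zero, one_mul]
    exact mul_le_of_le_one_right (Real.exp_pos _).le (abs_besselJ_zero_le _)
  have hR : Integrable (fun τ : ℝ =>
      (Real.exp (-(τ - t) ^ 2 / 2) : ℂ) * besselTransform r (-(I * τ))) := by
    have hm := measurable_besselTransform r
    refine (integrable_gaussian_mul_lightConeWeight hr t).mono'
      (Measurable.aestronglyMeasurable (by fun_prop)) ?_
    filter_upwards [ae_sub_ne_zero r] with τ hτ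
    rw [norm_mul, norm_real, Real.norm_of_nonneg (Real.exp_pos _).le]
    gcongr
    simpa using norm_besselTransform_le hτ.1 hτ.2 0
  rw [← imCLM.integral_comp_comm hR, imCLM_apply, im_ofReal_mul, ← imCLM_apply,
    ← imCLM.integral_comp_comm hL] at h
  have hpi : Real.sqrt (2 * Real.pi) ≠ 0 := by positivity
  have hl (ω : ℝ) : imCLM (cexp (I * t * ω) * (Real.exp (-ω ^ 2 / 2) * besselJ 0 (r * ω) : ℝ)) =
      Real.exp (-ω ^ 2 / 2) * (besselJ 0 (r * ω) * Real.sin (t * ω)) := by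
    rw [imCLM_apply, im_mul_ofReal, show I * t * ω = (t * ω : ℝ) * I by push_cast; ring,
      exp_ofReal_mul_I_im]
    ring
  simp only [hl] at h
  have hp := (integrable_gaussian_mul_lightConeWeight hr t).indicator (measurableSet_Ioi (a := r))
  have hn := ((integrable_gaussian_mul_lightConeWeight hr (-t)).indicator
    (measurableSet_Ioi (a := r))).comp_neg
  -- Reflecting τ on the half-line τ < -r turns the Gaussian centred at t into the one centred at
  -- -t.
  have hr' : (fun τ : ℝ => imCLM ((Real.exp (-(τ - t) ^ 2 / 2) : ℂ) *
      besselTransform r (-(I * τ)))) =ᵐ[volume] fun τ =>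
      (Ioi r).indicator (fun τ => Real.exp (-(τ - t) ^ 2 / 2) * lightConeWeight r τ) τ -
      (Ioi r).indicator (fun τ => Real.exp (-(τ - -t) ^ 2 / 2) * lightConeWeight r τ) (-τ) := by
    filter_upwards [ae_sub_ne_zero r] with τ hτ
    rw [imCLM_apply, im_ofReal_mul, im_besselTransform hr hτ.1 hτ.2, mul_sub]
    congr 1
    · by_cases hmem : τ ∈ Ioi r <;> simp [hmem]
    · by_cases hmem : -τ ∈ Ioi r
      · rw [indicator_of_mem hmem, indicator_of_mem hmem]
        ring_nf
      · rw [indicator_of_notMem hmem, indicator_of_notMem hmem, mul_zero]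
  rw [integral_congr_ae hr', integral_sub hp hn,
    integral_neg_eq_self (fun τ => (Ioi r).indicator
      (fun τ => Real.exp (-(τ - -t) ^ 2 / 2) * lightConeWeight r τ) τ) volume,
    integral_indicator measurableSet_Ioi, integral_indicator measurableSet_Ioi,
    ← halfPotential_eq_integral t hr, ← halfPotential_eq_integral (-t) hr, ← mul_sub] at h
  rw [mul_left_cancel₀ hpi h, potential]
  ring

theorem potential_eq_planarPotential (t : ℝ) {x : EuclideanSpace ℝ (Fin 2)} (hx : x ≠ 0) :
    potential t ‖x‖ = -planarPotential (t, x) := by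
  rw [(planarPotential_eq_integral t x).2, integral_besselJ_zero_mul_sin t (norm_pos_iff.2 hx),
    neg_neg]

end HankelForm

/-! ### Differentiation of the explicit integrals. -/

section PotentialDerivatives

open Topology

/-- An integrable envelope for the integrands of `calJ` and `halfPotential`. -/
noncomputable def envelope (b ξ : ℝ) : ℝ :=
  ξ ^ (-(1 / 2) : ℝ) * (1 + ξ) ^ 2 * Real.exp (-b * ξ ^ 2)

theorem integrableOn_envelope {b : ℝ} (hb : 0 < b) : IntegrableOn (envelope b) (Ioi 0) := by
  have h (s : ℝ) (hs : -1 < s) := integrableOn_rpow_mul_exp_neg_mul_sq hb hs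
  refine (((h (-(1 / 2)) (by norm_num)).add ((h (1 / 2) (by norm_num)).const_mul 2)).add
    (h (3 / 2) (by norm_num))).congr_fun (fun ξ hξ => ?_) measurableSet_Ioi
  have hξ' : 0 < ξ := hξ
  have e1 : ξ ^ (1 / 2 : ℝ) = ξ ^ (-(1 / 2) : ℝ) * ξ := by
    rw [← Real.rpow_add_one hξ'.ne']
    norm_num
  have e2 : ξ ^ (3 / 2 : ℝ) = ξ ^ (-(1 / 2) : ℝ) * ξ ^ 2 := by
    rw [← Real.rpow_add_natCast hξ'.ne']
    norm_num
  simp only [Pi.add_apply, envelope, e1, e2]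
  ring

/-- For y = r(1 + ξ), (y - t)²/2 ≥ y²/4 - t²/2 because (y - 2t)² ≥ 0. The bound is uniform for `t`
bounded and `r` bounded away from 0. -/
theorem exp_le_envelope_exp {ρ T t r ξ : ℝ} (hρ : 0 < ρ) (ht : |t| ≤ T) (hr : ρ ≤ r)
    (hξ : 0 < ξ) :
    Real.exp (-(r - t + r * ξ) ^ 2 / 2) ≤
      Real.exp (T ^ 2 / 2) * Real.exp (-(ρ ^ 2 / 4) * ξ ^ 2) := by
  rw [← Real.exp_add, Real.exp_le_exp]
  have h1 : t ^ 2 ≤ T ^ 2 := sq_le_sq' (abs_le.1 ht).1 (abs_le.1 ht).2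
  have h2 : (ρ * ξ) ^ 2 ≤ (r * (1 + ξ)) ^ 2 := by
    refine pow_le_pow_left₀ (by positivity) (mul_le_mul hr (by linarith) hξ.le ?_) 2
    linarith
  nlinarith [sq_nonneg (r * (1 + ξ) - 2 * t)]

theorem inv_sqrt_le {ξ : ℝ} (hξ : 0 < ξ) :
    1 / Real.sqrt (ξ * (ξ + 2)) ≤ ξ ^ (-(1 / 2) : ℝ) := by
  rw [Real.rpow_neg hξ.le, ← Real.sqrt_eq_rpow, ← one_div]
  refine one_div_le_one_div_of_le (Real.sqrt_pos.2 hξ) (Real.sqrt_le_sqrt ?_)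
  nlinarith

theorem abs_calJIntegrand_le {j : ℕ} (hj : j ≤ 1) {ρ T R t r ξ : ℝ} (hρ : 0 < ρ) (ht : |t| ≤ T)
    (hr : ρ ≤ r) (hR : r ≤ R) (hξ : 0 < ξ) :
    |calJIntegrand j t r ξ| ≤ (R + T) * Real.exp (T ^ 2 / 2) * envelope (ρ ^ 2 / 4) ξ := by
  have hr0 : 0 < r := hρ.trans_le hr
  have hT : 0 ≤ T := (abs_nonneg t).trans ht
  have hy : |r - t + r * ξ| ≤ (R + T) * (1 + ξ) := by
    obtain ⟨h1, h2⟩ := abs_le.1 ht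
    have := mul_nonneg hT hξ.le
    have := mul_nonneg (sub_nonneg.2 hR) hξ.le
    have := mul_pos hr0 hξ
    rw [abs_le]
    constructor <;> nlinarith
  have hp : (1 + ξ) ^ j ≤ 1 + ξ := by
    calc (1 + ξ) ^ j ≤ (1 + ξ) ^ 1 := pow_le_pow_right₀ (by linarith) hj
      _ = 1 + ξ := pow_one _
  rw [calJIntegrand, div_eq_mul_one_div, abs_mul, abs_mul, abs_mul, abs_of_pos (Real.exp_pos _),
    abs_of_nonneg (by positivity : 0 ≤ 1 / Real.sqrt (ξ * (ξ + 2))),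
    abs_of_nonneg (by positivity : 0 ≤ (1 + ξ) ^ j)]
  calc _ ≤ Real.exp (T ^ 2 / 2) * Real.exp (-(ρ ^ 2 / 4) * ξ ^ 2) * ξ ^ (-(1 / 2) : ℝ) *
        ((R + T) * (1 + ξ)) * (1 + ξ) := by
        gcongr
        · have : 0 ≤ R := hr0.le.trans hR
          positivity
        · exact exp_le_envelope_exp hρ ht hr hξ
        · exact inv_sqrt_le hξ
    _ = _ := by
        rw [envelope]
        ring

theorem abs_halfPotentialIntegrand_le {ρ T t r ξ : ℝ} (hρ : 0 < ρ) (ht : |t| ≤ T)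
    (hr : ρ ≤ r) (hξ : 0 < ξ) :
    |halfPotentialIntegrand t r ξ| ≤ Real.exp (T ^ 2 / 2) * envelope (ρ ^ 2 / 4) ξ := by
  rw [halfPotentialIntegrand, ← Real.sqrt_mul hξ.le, mul_comm ξ r,
    abs_of_nonneg (by positivity)]
  calc _ ≤ ξ ^ (-(1 / 2) : ℝ) * (Real.exp (T ^ 2 / 2) * Real.exp (-(ρ ^ 2 / 4) * ξ ^ 2)) := by
        gcongr
        · exact inv_sqrt_le hξ
        · exact exp_le_envelope_exp hρ ht hr hξ
    _ ≤ ξ ^ (-(1 / 2) : ℝ) * (Real.exp (T ^ 2 / 2) * Real.exp (-(ρ ^ 2 / 4) * ξ ^ 2)) *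
        (1 + ξ) ^ 2 := by
        refine le_mul_of_one_le_right (by positivity) ?_
        nlinarith
    _ = _ := by
        rw [envelope]
        ring

theorem measurable_calJIntegrand (j : ℕ) (t r : ℝ) : Measurable (calJIntegrand j t r) := by
  unfold calJIntegrand
  fun_prop

theorem measurable_halfPotentialIntegrand (t r : ℝ) :
    Measurable (halfPotentialIntegrand t r) := by
  unfold halfPotentialIntegrand
  fun_prop

theorem integrableOn_calJIntegrand {j : ℕ} (hj : j ≤ 1) (t : ℝ) {r : ℝ} (hr : 0 < r) :
    IntegrableOn (calJIntegrand j t r) (Ioi 0) := by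
  refine ((integrableOn_envelope (b := r ^ 2 / 4) (by positivity)).const_mul
    ((r + |t|) * Real.exp (|t| ^ 2 / 2))).mono' (measurable_calJIntegrand j t r).aestronglyMeasurable ?_
  filter_upwards [self_mem_ae_restrict measurableSet_Ioi] with ξ hξ
  exact abs_calJIntegrand_le hj hr le_rfl le_rfl le_rfl hξ

theorem integrableOn_halfPotentialIntegrand (t : ℝ) {r : ℝ} (hr : 0 < r) :
    IntegrableOn (halfPotentialIntegrand t r) (Ioi 0) := by
  refine ((integrableOn_envelope (b := r ^ 2 / 4) (by positivity)).const_mul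
    (Real.exp (|t| ^ 2 / 2))).mono' (measurable_halfPotentialIntegrand t r).aestronglyMeasurable ?_
  filter_upwards [self_mem_ae_restrict measurableSet_Ioi] with ξ hξ
  exact abs_halfPotentialIntegrand_le hr le_rfl le_rfl hξ

theorem hasDerivAt_halfPotentialIntegrand_time (t r : ℝ) {ξ : ℝ} (hξ : 0 < ξ) :
    HasDerivAt (fun s => halfPotentialIntegrand s r ξ) (calJIntegrand 0 t r ξ) t := by
  have h1 : HasDerivAt (fun s => r - s + ξ * r) (-1) t :=
    ((hasDerivAt_id t).const_sub r).add_const _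
  refine ((((h1.pow 2).neg.div_const 2).exp).const_mul
    (1 / (Real.sqrt ξ * Real.sqrt (ξ + 2)))).congr_deriv ?_
  simp only [Pi.neg_apply, Pi.pow_apply]
  rw [calJIntegrand, ← Real.sqrt_mul hξ.le, mul_comm r ξ]
  simp
  ring

theorem hasDerivAt_halfPotentialIntegrand_radius (t r : ℝ) {ξ : ℝ} (hξ : 0 < ξ) :
    HasDerivAt (fun y => halfPotentialIntegrand t y ξ) (-calJIntegrand 1 t r ξ) r := by
  have h1 : HasDerivAt (fun y => y - t + ξ * y) (1 + ξ * 1) r :=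
    ((hasDerivAt_id r).sub_const t).add ((hasDerivAt_id r).const_mul ξ)
  refine ((((h1.pow 2).neg.div_const 2).exp).const_mul
    (1 / (Real.sqrt ξ * Real.sqrt (ξ + 2)))).congr_deriv ?_
  simp only [Pi.neg_apply, Pi.pow_apply]
  rw [calJIntegrand, ← Real.sqrt_mul hξ.le, mul_comm r ξ]
  simp
  ring

theorem hasDerivAt_halfPotential_time (t : ℝ) {r : ℝ} (hr : 0 < r) :
    HasDerivAt (fun s => halfPotential s r) (calJ 0 t r) t := by
  refine HasDerivAt.const_mul _ (hasDerivAt_integral_of_dominated_loc_of_deriv_le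
    (Metric.ball_mem_nhds t one_pos)
    (.of_forall fun s => (measurable_halfPotentialIntegrand s r).aestronglyMeasurable)
    (integrableOn_halfPotentialIntegrand t hr) (measurable_calJIntegrand 0 t r).aestronglyMeasurable
    (F' := fun s ξ => calJIntegrand 0 s r ξ) ?_
    ((integrableOn_envelope (b := r ^ 2 / 4) (by positivity)).const_mul
    ((r + (|t| + 1)) * Real.exp ((|t| + 1) ^ 2 / 2))) ?_).2
  · filter_upwards [self_mem_ae_restrict measurableSet_Ioi] with ξ hξ s hs
    refine abs_calJIntegrand_le zero_le_one hr ?_ le_rfl le_rfl hξ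
    rw [Metric.mem_ball, Real.dist_eq] at hs
    linarith [abs_sub_abs_le_abs_sub s t]
  · filter_upwards [self_mem_ae_restrict measurableSet_Ioi] with ξ hξ s _
    exact hasDerivAt_halfPotentialIntegrand_time s r hξ

theorem hasDerivAt_halfPotential_radius (t : ℝ) {r : ℝ} (hr : 0 < r) :
    HasDerivAt (fun y => halfPotential t y) (-calJ 1 t r) r := by
  have h := (hasDerivAt_integral_of_dominated_loc_of_deriv_le (μ := volume.restrict (Ioi 0))
    (F := fun y ξ => halfPotentialIntegrand t y ξ)
    -- The lower end r/2 keeps the Gaussian decay in ξ uniform; the upper end 2r bounds the linear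
    -- factor.
    (Icc_mem_nhds (half_lt_self hr) (by linarith : r < 2 * r))
    (.of_forall fun y => (measurable_halfPotentialIntegrand t y).aestronglyMeasurable)
    (integrableOn_halfPotentialIntegrand t hr)
    (F' := fun y ξ => -calJIntegrand 1 t y ξ)
    (measurable_calJIntegrand 1 t r).neg.aestronglyMeasurable ?_
    ((integrableOn_envelope (b := (r / 2) ^ 2 / 4) (by positivity)).const_mul
    ((2 * r + |t|) * Real.exp (|t| ^ 2 / 2))) ?_).2.const_mul (1 / Real.sqrt (2 * Real.pi))
  · refine h.congr_deriv ?_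
    rw [integral_neg, mul_neg, calJ]
  · filter_upwards [self_mem_ae_restrict measurableSet_Ioi] with ξ hξ y hy
    rw [norm_neg]
    exact abs_calJIntegrand_le le_rfl (half_pos hr) le_rfl hy.1 hy.2 hξ
  · filter_upwards [self_mem_ae_restrict measurableSet_Ioi] with ξ hξ y _
    exact hasDerivAt_halfPotentialIntegrand_radius t y hξ

theorem hasDerivAt_potential_time (t : ℝ) {r : ℝ} (hr : 0 < r) :
    HasDerivAt (fun s => potential s r) (-pressure t r) t := by
  have h1 := hasDerivAt_halfPotential_time t hr
  have h2 := (hasDerivAt_halfPotential_time (-t) hr).scomp t (hasDerivAt_neg t)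
  refine (h1.neg.add h2).congr_deriv ?_
  rw [pressure, neg_smul, one_smul]
  ring

theorem hasDerivAt_potential_radius (t : ℝ) {r : ℝ} (hr : 0 < r) :
    HasDerivAt (fun y => potential t y) (radialVelocity t r) r := by
  refine ((hasDerivAt_halfPotential_radius t hr).neg.add
    (hasDerivAt_halfPotential_radius (-t) hr)).congr_deriv ?_
  rw [radialVelocity]
  ring

end PotentialDerivatives

/-! ### Transfer between the radial formulas and the planar solution. -/

section RadialReduction

open Topology

theorem hasFDerivAt_norm {x : EuclideanSpace ℝ (Fin 2)} (hx : x ≠ 0) :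
    HasFDerivAt (fun x : EuclideanSpace ℝ (Fin 2) => ‖x‖) (‖x‖⁻¹ • innerSL ℝ x) x := by
  have hx' : ‖x‖ ≠ 0 := norm_ne_zero_iff.2 hx
  have h := ((hasStrictFDerivAt_norm_sq x).hasFDerivAt).sqrt (pow_ne_zero 2 hx')
  simp only [Real.sqrt_sq (norm_nonneg _)] at h
  refine h.congr_fderiv ?_
  ext v
  simp
  field_simp

theorem pressure_norm_eq (t : ℝ) {x : EuclideanSpace ℝ (Fin 2)} (hx : x ≠ 0) :
    pressure t ‖x‖ = planarPressure (t, x) := by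
  have h1 := hasDerivAt_potential_time t (norm_pos_iff.2 hx)
  simp only [fun s => potential_eq_planarPotential s hx] at h1
  exact neg_injective (h1.unique (hasDerivAt_planarPotential t x).fun_neg)

/-- Both sides are the gradient of W(t, ‖x‖) = -Φ(t, x): the chain rule through the norm gives the
right one, u = -∇Φ the left one. -/
theorem planarVelocity_eq (t : ℝ) {x : EuclideanSpace ℝ (Fin 2)} (hx : x ≠ 0) :
    planarVelocity (t, x) = radialVelocity t ‖x‖ • (‖x‖⁻¹ • x) := by
  have h1 := (hasDerivAt_potential_radius t (norm_pos_iff.2 hx)).comp_hasFDerivAt x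
    (hasFDerivAt_norm hx)
  have h2 := (hasFDerivAt_planarPotential_right t x).fun_neg
  have heq : ((fun y => potential t y) ∘ fun x : EuclideanSpace ℝ (Fin 2) => ‖x‖) =ᶠ[𝓝 x]
      fun x => -planarPotential (t, x) := by
    filter_upwards [isOpen_ne.mem_nhds hx] with y hy
    exact potential_eq_planarPotential t hy
  have h3 := (h1.congr_of_eventuallyEq heq.symm).unique h2
  refine ext_inner_right ℝ fun v => ?_
  have h4 := congr($h3 v)
  simp only [neg_neg, innerSL_apply_apply, smul_apply] at h4
  rw [← h4, inner_smul_left, inner_smul_left]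
  simp

theorem radialVelocity_zero (r : ℝ) : radialVelocity 0 r = 0 := by
  simp [radialVelocity]

/-- Off the origin the velocity is radial with vanishing profile; continuity covers the origin. -/
theorem planarVelocity_zero (x : EuclideanSpace ℝ (Fin 2)) : planarVelocity (0, x) = 0 := by
  have hc : Continuous fun x => planarVelocity (0, x) :=
    contDiff_planarVelocity.continuous.comp (Continuous.prodMk_right 0)
  have h := hc.ext_on (dense_compl_singleton (0 : EuclideanSpace ℝ (Fin 2)))
    (continuous_const (y := (0 : EuclideanSpace ℝ (Fin 2)))) fun y hy => ?_
  · exact congrFun h x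
  · simp only
    rw [planarVelocity_eq 0 hy, radialVelocity_zero, zero_smul]

theorem isPlanarAcousticSolution_planar :
    IsPlanarAcousticSolution (fun t x => planarPressure (t, x))
      (fun t x => planarVelocity (t, x)) where
  contDiffOn_p := contDiff_planarPressure.contDiffOn
  contDiffOn_u := contDiff_planarVelocity.contDiffOn
  mass_eq t x _ := planar_mass_eq t x
  momentum_eq t x _ := planar_momentum_eq t x
  init_p := planarPressure_zero
  init_u := planarVelocity_zero

theorem norm_single_of_pos {r : ℝ} (hr : 0 < r) :
    ‖(EuclideanSpace.single 0 r : EuclideanSpace ℝ (Fin 2))‖ = r := by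
  rw [PiLp.norm_single, Real.norm_of_nonneg hr.le]

theorem single_ne_zero_of_pos {r : ℝ} (hr : 0 < r) :
    (EuclideanSpace.single 0 r : EuclideanSpace ℝ (Fin 2)) ≠ 0 := by
  rw [← norm_pos_iff, norm_single_of_pos hr]
  exact hr

theorem contDiff_single :
    ContDiff ℝ 2 fun r : ℝ => (EuclideanSpace.single 0 r : EuclideanSpace ℝ (Fin 2)) := by
  have : (fun r : ℝ => (EuclideanSpace.single 0 r : EuclideanSpace ℝ (Fin 2))) =
      fun r => r • EuclideanSpace.single 0 1 := by
    ext r i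
    simp
  rw [this]
  exact contDiff_id.smul contDiff_const

theorem potential_eq_of_pos (t : ℝ) {r : ℝ} (hr : 0 < r) :
    potential t r = -planarPotential (t, EuclideanSpace.single 0 r) := by
  rw [← potential_eq_planarPotential t (single_ne_zero_of_pos hr), norm_single_of_pos hr]

theorem pressure_eq_of_pos (t : ℝ) {r : ℝ} (hr : 0 < r) :
    pressure t r = planarPressure (t, EuclideanSpace.single 0 r) := by
  rw [← pressure_norm_eq t (single_ne_zero_of_pos hr), norm_single_of_pos hr]

theorem radialVelocity_eq_of_pos (t : ℝ) {r : ℝ} (hr : 0 < r) :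
    radialVelocity t r = planarVelocity (t, EuclideanSpace.single 0 r) 0 := by
  rw [planarVelocity_eq t (single_ne_zero_of_pos hr), norm_single_of_pos hr]
  simp [hr.ne']

/-- Φ is C² for all real times, so regularity up to t = 0 comes by restriction to the ray x = (r,
0). -/
theorem contDiffOn_potential :
    ContDiffOn ℝ 2 (fun z : ℝ × ℝ => potential z.1 z.2) (Ici 0 ×ˢ Ioi 0) := by
  have h : ContDiff ℝ 2 fun z : ℝ × ℝ => -planarPotential (z.1, EuclideanSpace.single 0 z.2) :=
    (contDiff_planarPotential.comp
      (contDiff_fst.prodMk (contDiff_single.comp contDiff_snd))).neg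
  exact h.contDiffOn.congr fun z hz => potential_eq_of_pos z.1 hz.2

theorem differentiableAt_radialVelocity (t : ℝ) {r : ℝ} (hr : 0 < r) :
    DifferentiableAt ℝ (radialVelocity t) r := by
  have h : Differentiable ℝ fun ρ : ℝ => planarVelocity (t, EuclideanSpace.single 0 ρ) 0 := by
    have h1 : Differentiable ℝ fun ρ : ℝ => planarVelocity (t, EuclideanSpace.single 0 ρ) :=
      (contDiff_planarVelocity.differentiable one_ne_zero).comp
        ((differentiable_const t).prodMk (contDiff_single.differentiable two_ne_zero))
    exact (EuclideanSpace.proj 0 : EuclideanSpace ℝ (Fin 2) →L[ℝ] ℝ).differentiable.comp h1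
  refine (h r).congr_of_eventuallyEq ?_
  filter_upwards [Ioi_mem_nhds hr] with ρ hρ
  exact radialVelocity_eq_of_pos t hρ

/-- The divergence of a radial velocity field. -/
theorem divergence_planarVelocity (t : ℝ) {r : ℝ} (hr : 0 < r) :
    ∑ i : Fin 2, (fderiv ℝ (fun x => planarVelocity (t, x)) (EuclideanSpace.single 0 r)
      (EuclideanSpace.single i 1)) i = deriv (radialVelocity t) r + radialVelocity t r / r := by
  set x : EuclideanSpace ℝ (Fin 2) := EuclideanSpace.single 0 r with hxdef
  have hx : x ≠ 0 := single_ne_zero_of_pos hr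
  have hn : ‖x‖ = r := norm_single_of_pos hr
  -- The field is (u_r/r) x, so its divergence is r (u_r/r)' + 2u_r/r.
  have hU := (differentiableAt_radialVelocity t hr).hasDerivAt.mul (hasDerivAt_inv hr.ne')
  rw [← hn] at hU
  have hV := (hU.comp_hasFDerivAt x (hasFDerivAt_norm hx)).smul (hasFDerivAt_id x)
  have heq : (fun x => planarVelocity (t, x)) =ᶠ[𝓝 x]
      (((radialVelocity t * fun y => y⁻¹) ∘ fun x : EuclideanSpace ℝ (Fin 2) => ‖x‖) • id) := by
    filter_upwards [isOpen_ne.mem_nhds hx] with y hy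
    rw [planarVelocity_eq t hy, smul_smul]
    rfl
  have hin (i : Fin 2) : inner ℝ x (EuclideanSpace.single i (1 : ℝ)) = x i := by
    rw [real_inner_comm, EuclideanSpace.inner_single_left]
    simp
  have hx0 : x 0 = r := by simp [hxdef]
  have hx1 : x 1 = 0 := by simp [hxdef]
  clear_value x
  rw [(hV.congr_of_eventuallyEq heq).fderiv]
  simp [hn, Fin.sum_univ_two, hin, hx0, hx1]
  field_simp
  ring

/-- This is the planar mass equation on the ray x = (r, 0), with p = -∂W/∂t, u_r = ∂W/∂r and the
radial form of the divergence. -/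
theorem potential_wave_eq (t : ℝ) {r : ℝ} (hr : 0 < r) :
    iteratedDeriv 2 (fun s => potential s r) t
      - 1 / r * deriv (fun ρ => ρ * deriv (fun y => potential t y) ρ) r = 0 := by
  have h1 : deriv (fun s => potential s r) =
      fun s => -planarPressure (s, EuclideanSpace.single 0 r) := by
    ext s
    rw [(hasDerivAt_potential_time s hr).deriv, pressure_eq_of_pos s hr]
  have h2 : (fun ρ => ρ * deriv (fun y => potential t y) ρ) =ᶠ[𝓝 r]
      fun ρ => ρ * radialVelocity t ρ := by
    filter_upwards [Ioi_mem_nhds hr] with ρ hρ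
    rw [(hasDerivAt_potential_radius t hρ).deriv]
  have h3 := (hasDerivAt_id r).fun_mul (differentiableAt_radialVelocity t hr).hasDerivAt
  have hm := planar_mass_eq t (EuclideanSpace.single 0 r)
  rw [divergence_planarVelocity t hr] at hm
  rw [iteratedDeriv_succ, iteratedDeriv_one, h1, deriv.fun_neg, h2.deriv_eq]
  have h4 : deriv (fun ρ => ρ * radialVelocity t ρ) r =
      1 * radialVelocity t r + r * deriv (radialVelocity t) r := h3.deriv
  rw [h4]
  field_simp at hm ⊢
  linarith

theorem isRadialSolution_potential : IsRadialSolution potential pressure radialVelocity where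
  contDiffOn := contDiffOn_potential
  wave_eq t _ _ hr := potential_wave_eq t hr
  init_value r _ := by simp [potential]
  init_deriv r hr := by
    have h := (hasDerivAt_potential_time 0 hr).hasDerivWithinAt (s := Ici 0)
    rwa [pressure_eq_of_pos 0 hr, planarPressure_zero, norm_single_of_pos hr] at h
  pressure_eq t _ _ hr := (hasDerivAt_potential_time t hr).hasDerivWithinAt
  velocity_eq t _ _ hr := hasDerivAt_potential_radius t hr

end RadialReduction

end AcousticPulse

theorem lemma4 :
    -- all the integrals converge absolutely
    (∀ t r : ℝ, 0 < r →
      (∀ j : ℕ, j ≤ 1 → IntegrableOn (AcousticPulse.calJIntegrand j t r) (Ioi 0)) ∧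
      IntegrableOn (AcousticPulse.halfPotentialIntegrand t r) (Ioi 0)) ∧
    -- the formulas give a solution of the radial Cauchy problem, with an explicit potential
    AcousticPulse.IsRadialSolution AcousticPulse.potential AcousticPulse.pressure
      AcousticPulse.radialVelocity ∧
    -- they are the pressure and the velocity of a solution of the acoustic system in the plane
    (∃ (p : ℝ → EuclideanSpace ℝ (Fin 2) → ℝ)
      (u : ℝ → EuclideanSpace ℝ (Fin 2) → EuclideanSpace ℝ (Fin 2)),
      AcousticPulse.IsPlanarAcousticSolution p u ∧
      ∀ (t : ℝ) (x : EuclideanSpace ℝ (Fin 2)), 0 ≤ t → x ≠ 0 →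
        p t x = AcousticPulse.pressure t ‖x‖ ∧
        u t x = AcousticPulse.radialVelocity t ‖x‖ • (‖x‖⁻¹ • x)) ∧
    -- they agree with the Fourier-Bessel form of the solution
    (∀ t r : ℝ, 0 ≤ t → 0 < r →
      (IntegrableOn (fun ω : ℝ => ω * Real.exp (-ω ^ 2 / 2) *
          (AcousticPulse.besselJ 0 (r * ω) * Real.cos (t * ω))) (Ioi 0) ∧
        AcousticPulse.pressure t r = ∫ ω in Ioi (0 : ℝ), ω * Real.exp (-ω ^ 2 / 2) *
          (AcousticPulse.besselJ 0 (r * ω) * Real.cos (t * ω))) ∧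
      (IntegrableOn (fun ω : ℝ => ω * Real.exp (-ω ^ 2 / 2) *
          (AcousticPulse.besselJ 1 (r * ω) * Real.sin (t * ω))) (Ioi 0) ∧
        AcousticPulse.radialVelocity t r = ∫ ω in Ioi (0 : ℝ), ω * Real.exp (-ω ^ 2 / 2) *
          (AcousticPulse.besselJ 1 (r * ω) * Real.sin (t * ω)))) := by
  refine ⟨fun t r hr => ⟨fun j hj => AcousticPulse.integrableOn_calJIntegrand hj t hr,
    AcousticPulse.integrableOn_halfPotentialIntegrand t hr⟩,
    AcousticPulse.isRadialSolution_potential,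
    ⟨_, _, AcousticPulse.isPlanarAcousticSolution_planar, fun t x _ hx =>
      ⟨(AcousticPulse.pressure_norm_eq t hx).symm, AcousticPulse.planarVelocity_eq t hx⟩⟩,
    fun t r _ hr => ⟨?_, ?_⟩⟩
  · have h := AcousticPulse.planarPressure_eq_integral t (EuclideanSpace.single 0 r)
    rwa [AcousticPulse.norm_single_of_pos hr, ← AcousticPulse.pressure_eq_of_pos t hr] at h
  · have h := AcousticPulse.planarVelocity_eq_integral t r
    rwa [← AcousticPulse.radialVelocity_eq_of_pos t hr] at h
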